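/- Let $d\ge 2$. There is a constant $K_d>0$, depending only on $d$, with the following property. Let $f:\mathbb{R}^d\to\mathbb{R}$ be $2\pi$-periodic in each variable (a function on the torus $\mathbb{T}^d$) and of bounded variation in each variable on $[0,2\pi]$, and for each direction $j$ let $J_j:\mathbb{R}\to\mathbb{R}$ give the jump of $f$ across the hyperplane $x_j=\alpha$, that is, $$f(x_1,\dots,x_j^{+},\dots,x_d)-f(x_1,\dots,x_j^{-},\dots,x_d)=J_j(x_j)\qquad\text{for all } x\in\mathbb{R}^d,$$ the one-sided limits being taken in the variable $x_j$. Suppose that $f$ is continuous at every $x$ with $J_j(x_j)=0$ for all $j$, and that for each $j$ the partial derivative $\partial_{x_j}f$ is a function of bounded variation in all variables in the sense of Hardy and Krause on $[0,2\pi]^d$. Here $\partial_{x_j}f$ is understood away from the jumps: it is a function $g_j$, $2\pi$-periodic in each variable, such that on every line $t\mapsto(x_1,\dots,t,\dots,x_d)$ parallel to $e_j$ and for all $a\le b$ $$f(\dots,b^{+},\dots)-f(\dots,a^{+},\dots)=\int_a^b g_j(\dots,t,\dots)\,dt+\sum_{\alpha\in(a,b]}J_j(\alpha).$$ For $\nu\in\mathbb{Z}^d$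 and $n\in\mathbb{N}$ put $$c_\nu=\frac1{(2\pi)^d}\int_{[0,2\pi]^d}f(x)e^{-i\nu\cdot x}\,dx,\qquad G(n)=\sum_{|\nu_k|\le n\ \forall k}|c_\nu|,\qquad \|\nu\|_\infty=\max_k|\nu_k|,$$ $$\widetilde S_{j,n}(x;f)=-i\sum_{|\nu_k|\le n\ \forall k}\operatorname{sign}(\nu_j)\,c_\nu e^{i\nu\cdot x},\qquad Y_{j,n}(x)=-\frac1{\log(n)\,G(n)}\sum_{|\nu_k|\le n\ \forall k}\widetilde S_{j,\|\nu\|_\infty}(x;f)\,|c_\nu|,$$ with $\operatorname{sign}(0)=0$, and $Y_{j,n}(x)=0$ if $\log(n)\,G(n)=0$. Then for every $j\in\{1,\dots,d\}$ and every $x$ $$\lim_{n\to\infty}Y_{j,n}(x)=K_d\,\frac{J_j(x_j)}{(2\pi)^d}.$$ -/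

import Mathlib

open Filter Topology MeasureTheory Set

noncomputable section

namespace TorusJump

/-- The restriction of `f` to the line through `x` in the direction `e_j`. -/
def lineSection {d : ℕ} (f : (Fin d → ℝ) → ℝ) (j : Fin d) (x : Fin d → ℝ) : ℝ → ℝ :=
  fun t => f (Function.update x j t)

/-- `2π`-periodicity in each variable: `f` is a function on the torus. -/
def TorusPeriodic {d : ℕ} (f : (Fin d → ℝ) → ℝ) : Prop :=
  ∀ (j : Fin d) (x : Fin d → ℝ), Function.Periodic (lineSection f j x) (2 * Real.pi)

/-- The jump `f(x_j⁺) - f(x_j⁻)` of `f` at `x` in the direction `e_j`. -/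
def jumpAt {d : ℕ} (f : (Fin d → ℝ) → ℝ) (j : Fin d) (x : Fin d → ℝ) : ℝ :=
  Function.rightLim (lineSection f j x) (x j) - Function.leftLim (lineSection f j x) (x j)

/-- Alternating sum of `g` over the vertices of the cell `∏_{k ∈ u} [a k, b k]` of the face
`{x | x k = 0 for k ∉ u}`. -/
def mixedDiff {d : ℕ} (g : (Fin d → ℝ) → ℝ) (u : Finset (Fin d)) (a b : Fin d → ℝ) : ℝ :=
  ∑ s ∈ u.powerset,
    (-1 : ℝ) ^ (u \ s).card * g (fun k => if k ∈ s then b k else if k ∈ u then a k else 0)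

/-- Bounded variation in all variables, in the sense of Hardy and Krause, on `[0, 2π]^d`:
for each nonempty set `u` of variables, the Vitali variation on the face `x k = 0`, `k ∉ u`, is
finite. A grid is given by finite nondecreasing sequences `p k 0 ≤ … ≤ p k N` in `[0, 2π]`
(repetitions give degenerate cells, which contribute `0`). -/
def BVHardyKrause {d : ℕ} (g : (Fin d → ℝ) → ℝ) : Prop :=
  ∀ u : Finset (Fin d), u.Nonempty → ∃ C : ℝ, ∀ (N : ℕ) (p : Fin d → ℕ → ℝ),
    (∀ k, Monotone (p k)) → (∀ k i, p k i ∈ Icc (0 : ℝ) (2 * Real.pi)) →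
    ∑ i ∈ Fintype.piFinset (fun k => if k ∈ u then Finset.range N else {0}),
      |mixedDiff g u (fun k => p k (i k)) (fun k => p k (i k + 1))| ≤ C

/-- `g` is the partial derivative `∂_j f`, where `f` has the jumps `J α` across `x_j = α`:
on each line parallel to `e_j` the increments of `f` are the sum of its jumps and of the integral
of `g`. In other words, the derivative measure of `f` along the line is
`g dt + ∑_α J α δ_α`: away from the jumps `f` is absolutely continuous with derivative `g`. -/
def IsPartialDeriv {d : ℕ} (f : (Fin d → ℝ) → ℝ) (J : ℝ → ℝ) (j : Fin d)
    (g : (Fin d → ℝ) → ℝ) : Prop :=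
  ∀ (x : Fin d → ℝ) (a b : ℝ), a ≤ b →
    Function.rightLim (lineSection f j x) b - Function.rightLim (lineSection f j x) a =
      (∫ t in a..b, lineSection g j x t) + ∑' α : Ioc a b, J α

/-- The functions on the `d`-torus under consideration: of bounded variation in each variable,
with a jump `J j α` across each hyperplane `x_j = α`, continuous off the hyperplanes with nonzero
jump, and whose partial derivatives are of bounded variation in all variables. -/
structure HasHyperplaneJumps {d : ℕ} (f : (Fin d → ℝ) → ℝ) (J : Fin d → ℝ → ℝ) : Prop where
  periodic : TorusPeriodic f
  bv : ∀ (j : Fin d) (x : Fin d → ℝ),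
    BoundedVariationOn (lineSection f j x) (Icc 0 (2 * Real.pi))
  jump_eq : ∀ (j : Fin d) (x : Fin d → ℝ), jumpAt f j x = J j (x j)
  continuousAt : ∀ x : Fin d → ℝ, (∀ j, J j (x j) = 0) → ContinuousAt f x
  partial_bv : ∀ j : Fin d, ∃ g : (Fin d → ℝ) → ℝ,
    TorusPeriodic g ∧ BVHardyKrause g ∧ IsPartialDeriv f (J j) j g

/-- The character `e^{i ν·x}`. -/
def character {d : ℕ} (ν : Fin d → ℤ) (x : Fin d → ℝ) : ℂ :=
  Complex.exp (Complex.I * ∑ k, (ν k : ℂ) * (x k : ℂ))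

/-- The Fourier coefficient `c_ν = (2π)^{-d} ∫_{[0,2π]^d} f(x) e^{-i ν·x} dx`. -/
def fourierCoeffTorus {d : ℕ} (f : (Fin d → ℝ) → ℝ) (ν : Fin d → ℤ) : ℂ :=
  (1 / (2 * (Real.pi : ℂ)) ^ d) *
    ∫ x in Icc (0 : Fin d → ℝ) (fun _ => 2 * Real.pi), (f x : ℂ) * character (-ν) x

/-- The frequencies `ν` with `|ν_k| ≤ n` for all `k`. -/
def freqBox (d n : ℕ) : Finset (Fin d → ℤ) :=
  Fintype.piFinset fun _ => Finset.Icc (-(n : ℤ)) (n : ℤ)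

/-- The maximum norm `‖ν‖_∞`, a natural number. -/
def supNorm {d : ℕ} (ν : Fin d → ℤ) : ℕ :=
  Finset.univ.sup fun k => (ν k).natAbs

/-- The rectangular partial sum of the `j`-th conjugate Fourier series. -/
def conjPartialSum {d : ℕ} (f : (Fin d → ℝ) → ℝ) (j : Fin d) (n : ℕ) (x : Fin d → ℝ) : ℂ :=
  -Complex.I * ∑ ν ∈ freqBox d n,
    ((ν j).sign : ℂ) * fourierCoeffTorus f ν * character ν x

/-- `G(n) = ∑_{|ν_k| ≤ n} |c_ν|`. -/
def coeffSum {d : ℕ} (f : (Fin d → ℝ) → ℝ) (n : ℕ) : ℝ :=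
  ∑ ν ∈ freqBox d n, ‖fourierCoeffTorus f ν‖

/-- The normalized average `Y_{j,n}(x)` of the conjugate partial sums. -/
def normalizedAverage {d : ℕ} (f : (Fin d → ℝ) → ℝ) (j : Fin d) (n : ℕ)
    (x : Fin d → ℝ) : ℂ :=
  -(1 / ((Real.log n * coeffSum f n : ℝ) : ℂ)) *
    ∑ ν ∈ freqBox d n,
      conjPartialSum f j (supNorm ν) x * (‖fourierCoeffTorus f ν‖ : ℂ)

end TorusJump

end

/-! The jumps are subtracted from `f`. For each direction `k` let `Φ_k = jumpPart (jumpWeight J k)`,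
the superposition of sawtooth functions with the jumps `J k`, and let `F = regularPart f J = f - ∑
Φ_k(x_k)`. The coefficients of `Φ_k(x_k)` live on the `k`-th frequency axis and equal `E_k(m) /
(2πim)`, where `E_k(m) = ∑ J_k(α) e^{-imα}` over one period (`expSum`).

The coefficients of `F` are absolutely summable. Off the jump hyperplanes, the increments of `F` in
direction `j` are integrals of `g_j` plus a constant. One increment in direction `j` is combined
with a mixed difference over the support of `ν`, with half-wavelength steps. This multiplies the
`ν`-th coefficient by a number of modulus at least `1`. Averaging over a grid of translates and
using the Hardy-Krause variation of `g_j` bounds the coefficient by `C / (|ν_j| ∏ max(1, |ν_k|))`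
(`norm_fourierCoeffTorus_regularPart_le`). The best choice of `j` makes this summable
(`one_div_mul_prod_le`).

Up to bounded errors, `-S̃_{j,n}(x)` is therefore `(2π)⁻¹ ∑_{m ≤ n} a_m / m`, where `a_m` adds the
rotated values `E_j(±m) e^{±imx_j}`, and `G(n)` is `π⁻¹ ∑_k ∑_{m ≤ n} |E_k(m)| / m`. Logarithmic
means of characters vanish except for the trivial one, so the mean of `E_j(m) e^{imt}` is `J_j(t)`
and `-S̃_{j,n}(x) / log n → J_j(x_j) / π` (`tendsto_conjPartialSum_div_log`). The sequence `|E_k|`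
also has a logarithmic mean, which is at least every `|J_k(t)|`. Hence `G(n) / log n → C`, with `C >
0` as soon as some jump is nonzero (`exists_tendsto_coeffSum_div_log`).

Grouping frequencies by `‖ν‖_∞` turns `Y_{j,n}` into a mean of `-S̃_{j,m}` with weights `G(m) -
G(m-1)`, divided by `log n`. When `G(n) ~ C log n` with `C > 0`, Abel summation shows that this mean
of `log m` is asymptotically `log n / 2` (`tendsto_weightedSum`). When `J_j(x_j) = 0`, monotonicity
of `G` suffices. The limit is `J_j(x_j) / (2π)`, hence `K_d = (2π)^{d-1}`. -/

noncomputable section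

namespace TorusJump

/-! ### Differences over grids of functions of bounded Hardy-Krause variation -/

section

/-- Alternating sum of `g` over the vertices of the cell `∏_{k ∈ u} [a k, b k]` of the face
`{x | x k = b k for k ∉ u}`. -/
def faceDiff {d : ℕ} (g : (Fin d → ℝ) → ℝ) (u : Finset (Fin d)) (a b : Fin d → ℝ) : ℝ :=
  ∑ s ∈ u.powerset,
    (-1 : ℝ) ^ (u \ s).card * g (fun k => if k ∈ u \ s then a k else b k)

variable {d : ℕ} {g : (Fin d → ℝ) → ℝ}

theorem mixedDiff_eq_faceDiff (u : Finset (Fin d)) (a b : Fin d → ℝ) (hb : ∀ k ∉ u, b k = 0) :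
    mixedDiff g u a b = faceDiff g u a b := by
  refine Finset.sum_congr rfl fun s hs => ?_
  congr 2
  funext k
  have hs' := Finset.mem_powerset.1 hs
  by_cases hk : k ∈ s
  · simp [hk]
  · by_cases hu : k ∈ u
    · simp [hk, hu]
    · simp [hk, hu, hb k hu]

theorem faceDiff_congr (u : Finset (Fin d)) {a a' b b' : Fin d → ℝ}
    (ha : ∀ k ∈ u, a k = a' k) (hb : ∀ k, b k = b' k) :
    faceDiff g u a b = faceDiff g u a' b' := by
  refine Finset.sum_congr rfl fun s hs => ?_
  congr 2
  funext k
  by_cases hk : k ∈ u \ s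
  · simp only [hk, if_true]; exact ha k (Finset.mem_sdiff.1 hk).1
  · simp only [hk, if_false]; exact hb k

theorem faceDiff_empty (a b : Fin d → ℝ) : faceDiff g ∅ a b = g b := by
  simp [faceDiff]

/-- Subsets of `insert k u` are split according to whether they contain `k`. The anchor is a free
parameter of `faceDiff`, so a variable can be differenced or frozen one at a time; the reduction of
arbitrary grids to anchored ones rests on this. -/
theorem faceDiff_insert {u : Finset (Fin d)} {k : Fin d} (hk : k ∉ u) (a b : Fin d → ℝ) :
    faceDiff g (insert k u) a b =
      faceDiff g u a b - faceDiff g u a (Function.update b k (a k)) := by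
  unfold faceDiff
  rw [Finset.sum_powerset_insert hk, add_comm, sub_eq_add_neg, ← Finset.sum_neg_distrib]
  congr 1
  · refine Finset.sum_congr rfl fun s hs => ?_
    have hs' := Finset.mem_powerset.1 hs
    have : insert k u \ insert k s = u \ s := by
      ext l; simp only [Finset.mem_sdiff, Finset.mem_insert]; grind
    rw [this]
  · refine Finset.sum_congr rfl fun s hs => ?_
    have hs' := Finset.mem_powerset.1 hs
    have hks : k ∉ s := fun h => hk (hs' h)
    have : insert k u \ s = insert k (u \ s) := by
      ext l; simp only [Finset.mem_sdiff, Finset.mem_insert]; grind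
    rw [this, Finset.card_insert_of_notMem (by simp [hk])]
    have h2 : (fun l => if l ∈ insert k (u \ s) then a l else b l) =
        fun l => if l ∈ u \ s then a l else Function.update b k (a k) l := by
      funext l
      by_cases hl : l = k
      · subst hl; simp [hk]
      · simp [hl]
    rw [h2]; ring

theorem faceDiff_eq_sub {u : Finset (Fin d)} {k : Fin d} (hk : k ∈ u) (a b : Fin d → ℝ) :
    faceDiff g u a b = faceDiff g (u.erase k) a (Function.update b k (b k)) -
      faceDiff g (u.erase k) a (Function.update b k (a k)) := by
  conv_lhs => rw [← Finset.insert_erase hk]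
  rw [faceDiff_insert (Finset.notMem_erase k u), Function.update_eq_self]

theorem TorusPeriodic.update_add (hg : TorusPeriodic g) (k : Fin d) (x : Fin d → ℝ) (t : ℝ)
    (n : ℤ) : g (Function.update x k (t + n * (2 * Real.pi))) = g (Function.update x k t) :=
  (hg k x).int_mul n t

theorem faceDiff_periodic (hg : TorusPeriodic g) {u : Finset (Fin d)} {k : Fin d} (hk : k ∉ u)
    (a b : Fin d → ℝ) (t : ℝ) (n : ℤ) :
    faceDiff g u a (Function.update b k (t + n * (2 * Real.pi))) =
      faceDiff g u a (Function.update b k t) := by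
  refine Finset.sum_congr rfl fun s hs => ?_
  have key : ∀ r : ℝ, (fun l => if l ∈ u \ s then a l else Function.update b k r l) =
      Function.update (fun l => if l ∈ u \ s then a l else b l) k r := by
    intro r
    funext l
    by_cases hl : l = k
    · subst hl; simp [hk]
    · simp [hl]
  rw [key, key, hg.update_add]

/-- The sum of `|faceDiff g u|` over the cells of a grid. -/
def gridVar (g : (Fin d → ℝ) → ℝ) (u : Finset (Fin d)) (N : ℕ) (a b : Fin d → ℕ → ℝ) : ℝ :=
  ∑ i ∈ Fintype.piFinset (fun k => if k ∈ u then Finset.range N else {0}),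
    |faceDiff g u (fun k => a k (i k)) (fun k => b k (i k))|

/-- Grids anchored at `0` and contained in `[0, 2π]` in the variables outside `v`, and less
restricted in the variables in `v`. -/
def AdmissibleGrid (v u : Finset (Fin d)) (a b : Fin d → ℕ → ℝ) : Prop :=
  (∀ k ∈ u, ∃ (p : ℕ → ℝ) (n : ℤ), Monotone p ∧ (∀ i, a k i = p i) ∧ (∀ i, b k i = p (i + 1)) ∧
    (∀ i, n * (2 * Real.pi) ≤ p i ∧ p i ≤ n * (2 * Real.pi) + 4 * Real.pi) ∧
    (k ∉ v → ∀ i, p i ∈ Icc (0 : ℝ) (2 * Real.pi))) ∧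
  ∀ k ∉ u, k ∉ v → b k 0 = 0

theorem gridVar_bound_empty (hb : BVHardyKrause g) (u : Finset (Fin d)) :
    ∃ C : ℝ, ∀ (N : ℕ) (a b : Fin d → ℕ → ℝ), AdmissibleGrid ∅ u a b →
      gridVar g u (N + 1) a b ≤ C := by
  rcases u.eq_empty_or_nonempty with rfl | hu
  · refine ⟨|g fun _ => 0|, fun N a b hab => le_of_eq ?_⟩
    have hs : Fintype.piFinset (fun k : Fin d =>
        if k ∈ (∅ : Finset (Fin d)) then Finset.range (N + 1) else {0}) = {fun _ => 0} := by
      ext i; simp [funext_iff]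
    rw [gridVar, hs, Finset.sum_singleton, faceDiff_empty]
    congr 2
    funext k
    exact hab.2 k (by simp) (by simp)
  · obtain ⟨C, hC⟩ := hb u hu
    refine ⟨C, fun N a b hab => ?_⟩
    choose! p n hp using hab.1
    refine le_trans (le_of_eq ?_) (hC (N + 1) (fun k => if k ∈ u then p k else fun _ => 0) ?_ ?_)
    · refine Finset.sum_congr rfl fun i hi => ?_
      rw [mixedDiff_eq_faceDiff]
      · congr 1
        refine faceDiff_congr u (fun k hk => ?_) (fun k => ?_)
        · simp [hk, (hp k hk).2.1]
        · by_cases hk : k ∈ u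
          · simp [hk, (hp k hk).2.2.1]
          · have : i k = 0 := by
              have := Fintype.mem_piFinset.1 hi k
              simpa [hk] using this
            simp [hk, this, hab.2 k hk]
      · intro k hk; simp [hk]
    · intro k
      by_cases hk : k ∈ u
      · simpa [hk] using (hp k hk).1
      · simpa [hk] using monotone_const
    · intro k i
      by_cases hk : k ∈ u
      · simpa [hk] using (hp k hk).2.2.2.2 (by simp) i
      · simp [hk, Real.pi_pos.le]

/-- The definition of Hardy-Krause variation only sees faces through `0` and grids in one fixed
period. Periodicity removes both restrictions one variable at a time, by induction on the set `v` of
released variables. A differenced variable has its grid cut at the period boundary; a frozen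
variable has its anchor moved to `0` at the price of one more difference. -/
theorem gridVar_bound (hg : TorusPeriodic g) (hb : BVHardyKrause g) (v : Finset (Fin d)) :
    ∀ u : Finset (Fin d), ∃ C : ℝ, ∀ (N : ℕ) (a b : Fin d → ℕ → ℝ), AdmissibleGrid v u a b →
      gridVar g u (N + 1) a b ≤ C := by
  have hpi := Real.pi_pos
  induction v using Finset.induction_on with
  | empty => exact gridVar_bound_empty hb
  | insert k v hkv ih =>
    intro u
    by_cases hku : k ∈ u
    · obtain ⟨C, hC⟩ := ih u
      refine ⟨C + C, fun N a b hab => ?_⟩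
      obtain ⟨p, n, hp, ha, hb', hpn, -⟩ := hab.1 k hku
      -- The grid spans at most two periods. Here `q` is its part in the first one, stopped at `2π`,
      -- and `r` its part in the second one, moved back by `2π`. Both are monotone in `[0, 2π]`, and
      -- each increment over `p` is the sum of the increments over `q` and `r`.
      let q : ℕ → ℝ := fun i => min (p i - n * (2 * Real.pi)) (2 * Real.pi)
      let r : ℕ → ℝ := fun i => max (p i - n * (2 * Real.pi)) (2 * Real.pi) - 2 * Real.pi
      have hq : Monotone q := fun i j hij => by
        have := hp hij
        simp only [q]; gcongr
      have hr : Monotone r := fun i j hij => by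
        have := hp hij
        simp only [r]; gcongr
      have hadm : ∀ w : ℕ → ℝ, Monotone w → (∀ i, w i ∈ Icc (0 : ℝ) (2 * Real.pi)) →
          AdmissibleGrid v u (Function.update a k w)
            (Function.update b k (fun i => w (i + 1))) := by
        intro w hw hwi
        refine ⟨fun l hl => ?_, fun l hl hlv => ?_⟩
        · by_cases hlk : l = k
          · subst hlk
            refine ⟨w, 0, hw, by simp, by simp, fun i => ?_, fun _ => hwi⟩
            have := hwi i
            simp only [mem_Icc] at this
            constructor <;> simp <;> linarith
          · obtain ⟨p', n', h1, h2, h3, h4, h5⟩ := hab.1 l hl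
            exact ⟨p', n', h1, by simpa [hlk] using h2, by simpa [hlk] using h3, h4,
              fun h => h5 (by simp [hlk, h])⟩
        · have hlk : l ≠ k := fun h => hl (h ▸ hku)
          simpa [hlk] using hab.2 l hl (by simp [hlk, hlv])
      have h1 := hC N _ _ (hadm q hq fun i => by
        have := (hpn i).1
        simp only [q, mem_Icc, le_min_iff, min_le_iff]
        exact ⟨⟨by linarith, by linarith⟩, Or.inr le_rfl⟩)
      have h2 := hC N _ _ (hadm r hr fun i => by
        have := (hpn i).2
        simp only [r, mem_Icc, sub_nonneg, le_max_iff, sub_le_iff_le_add, max_le_iff]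
        exact ⟨Or.inr le_rfl, by linarith, by linarith⟩)
      refine le_trans ?_ (add_le_add h1 h2)
      rw [gridVar, gridVar, gridVar, ← Finset.sum_add_distrib]
      refine Finset.sum_le_sum fun i _ => ?_
      set ψ : ℝ → ℝ := fun t => faceDiff g (u.erase k) (fun l => a l (i l))
        (Function.update (fun l => b l (i l)) k t) with hψ
      have hper : ∀ (t : ℝ) (m : ℤ), ψ (t + m * (2 * Real.pi)) = ψ t := fun t m =>
        faceDiff_periodic hg (Finset.notMem_erase k u) _ _ t m
      have hsplit : ∀ i, ψ (p i) = ψ (q i) + ψ (r i) - ψ 0 := by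
        intro i
        have e1 : ψ (p i) = ψ (p i - n * (2 * Real.pi)) := by
          rw [← hper (p i - n * (2 * Real.pi)) n]; congr 1; ring
        rw [e1]
        have e0 : ψ (2 * Real.pi) = ψ 0 := by
          rw [← hper 0 1]; congr 1; push_cast; ring
        rcases le_total (p i - n * (2 * Real.pi)) (2 * Real.pi) with h | h
        · have e2 : q i = p i - n * (2 * Real.pi) := min_eq_left h
          have e3 : r i = 0 := by simp only [r]; rw [max_eq_right h]; ring
          rw [e2, e3]; ring
        · have e2 : q i = 2 * Real.pi := min_eq_right h
          have e3 : r i = p i - n * (2 * Real.pi) - 2 * Real.pi := by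
            simp only [r]; rw [max_eq_left h]
          have e4 : ψ (r i) = ψ (p i - n * (2 * Real.pi)) := by
            rw [e3, ← hper (p i - n * (2 * Real.pi) - 2 * Real.pi) 1]; congr 1; push_cast; ring
          rw [e2, e4, e0]; ring
      have hF : faceDiff g u (fun l => a l (i l)) (fun l => b l (i l)) =
          ψ (p (i k + 1)) - ψ (p (i k)) := by
        rw [faceDiff_eq_sub hku, hb', ha]
      have hW : ∀ w : ℕ → ℝ, faceDiff g u (fun l => Function.update a k w l (i l))
          (fun l => Function.update b k (fun i => w (i + 1)) l (i l)) =
            ψ (w (i k + 1)) - ψ (w (i k)) := by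
        intro w
        rw [faceDiff_eq_sub hku]
        have hc : ∀ t, faceDiff g (u.erase k) (fun l => Function.update a k w l (i l))
            (Function.update (fun l => Function.update b k (fun i => w (i + 1)) l (i l)) k t) =
            ψ t := by
          intro t
          refine faceDiff_congr _ (fun l hl => ?_) (fun l => ?_)
          · rw [Function.update_of_ne (Finset.ne_of_mem_erase hl)]
          · by_cases hl : l = k
            · subst hl; simp
            · simp [hl]
        rw [hc, hc]; simp
      rw [hF, hW, hW, hsplit, hsplit]
      refine le_trans (le_of_eq ?_) (abs_add_le _ _)
      congr 1; ring
    · obtain ⟨C₁, hC₁⟩ := ih u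
      obtain ⟨C₂, hC₂⟩ := ih (insert k u)
      refine ⟨C₁ + C₂, fun N a b hab => ?_⟩
      obtain ⟨y, n, hy, hyn⟩ : ∃ (y : ℝ) (n : ℤ), y ∈ Icc (0 : ℝ) (2 * Real.pi) ∧
          b k 0 = y + n * (2 * Real.pi) := by
        refine ⟨toIcoMod Real.two_pi_pos 0 (b k 0), toIcoDiv Real.two_pi_pos 0 (b k 0), ?_, ?_⟩
        · have := toIcoMod_mem_Ico Real.two_pi_pos 0 (b k 0)
          rw [zero_add] at this
          exact Ico_subset_Icc_self this
        · have := toIcoMod_add_toIcoDiv_zsmul Real.two_pi_pos 0 (b k 0)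
          rw [zsmul_eq_mul] at this
          exact this.symm
      have hadm1 : AdmissibleGrid v u a (Function.update b k fun _ => 0) := by
        refine ⟨fun l hl => ?_, fun l hl hlv => ?_⟩
        · have hlk : l ≠ k := fun h => hku (h ▸ hl)
          obtain ⟨p', n', h1, h2, h3, h4, h5⟩ := hab.1 l hl
          exact ⟨p', n', h1, h2, by simpa [hlk] using h3, h4, fun h => h5 (by simp [hlk, h])⟩
        · by_cases hlk : l = k
          · subst hlk; simp
          · simpa [hlk] using hab.2 l hl (by simp [hlk, hlv])
      -- The value at the anchor `y` is the value at `0` plus the difference over `[0, y]`. That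
      -- difference is cell number `0` of the grid `0, y, y, …`; the bound being stated for `N + 1`
      -- cells guarantees that this cell is present.
      have hadm2 : AdmissibleGrid v (insert k u)
          (Function.update a k fun i => if i = 0 then 0 else y)
          (Function.update b k fun _ => y) := by
        refine ⟨fun l hl => ?_, fun l hl hlv => ?_⟩
        · by_cases hlk : l = k
          · subst hlk
            refine ⟨fun i => if i = 0 then 0 else y, 0, ?_, by simp, by simp, fun i => ?_,
              fun _ i => ?_⟩
            · intro i j hij
              by_cases hi : i = 0
              · by_cases hj : j = 0
                · simp [hi, hj]
                · simp [hi, hj, hy.1]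
              · have hj : j ≠ 0 := by omega
                simp [hi, hj]
            · have h1 := hy.1
              have h2 := hy.2
              dsimp only
              split_ifs <;> constructor <;> simp <;> linarith
            · dsimp only
              split_ifs
              · exact ⟨le_rfl, by linarith⟩
              · exact hy
          · obtain ⟨p', n', h1, h2, h3, h4, h5⟩ := hab.1 l (by simpa [hlk] using hl)
            exact ⟨p', n', h1, by simpa [hlk] using h2, by simpa [hlk] using h3, h4,
              fun h => h5 (by simp [hlk, h])⟩
        · simp only [Finset.mem_insert, not_or] at hl
          simpa [hl.1] using hab.2 l hl.2 (by simp [hl.1, hlv])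
      refine le_trans ?_ (add_le_add (hC₁ N _ _ hadm1) (hC₂ N _ _ hadm2))
      have hsub : Fintype.piFinset (fun l => if l ∈ u then Finset.range (N + 1) else {0}) ⊆
          Fintype.piFinset (fun l => if l ∈ insert k u then Finset.range (N + 1) else {0}) := by
        refine Fintype.piFinset_subset _ _ fun l => ?_
        by_cases hl : l ∈ u
        · simp [hl]
        · by_cases hlk : l = k
          · simp [hlk, hku]
          · simp [hl, hlk]
      refine le_trans ?_ (add_le_add le_rfl
        (Finset.sum_le_sum_of_subset_of_nonneg hsub fun _ _ _ => abs_nonneg _))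
      rw [gridVar, gridVar, ← Finset.sum_add_distrib]
      refine Finset.sum_le_sum fun i hi => ?_
      have hik : i k = 0 := by
        have := Fintype.mem_piFinset.1 hi k
        simpa [hku] using this
      refine le_trans (le_of_eq ?_) (abs_add_le _ _)
      congr 1
      rw [faceDiff_insert hku]
      have e1 : ∀ t, faceDiff g u
          (fun l => Function.update a k (fun i => if i = 0 then 0 else y) l (i l))
          (Function.update (fun l => b l (i l)) k t) =
          faceDiff g u (fun l => a l (i l)) (Function.update (fun l => b l (i l)) k t) := by
        intro t
        refine faceDiff_congr _ (fun l hl => ?_) (fun l => rfl)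
        have hlk : l ≠ k := fun h => hku (h ▸ hl)
        simp [hlk]
      have e2 : ∀ t : ℝ, (fun l => Function.update b k (fun _ => t) l (i l)) =
          Function.update (fun l => b l (i l)) k t := by
        intro t
        funext l
        by_cases hlk : l = k
        · subst hlk; simp
        · simp [hlk]
      rw [e2, e2, Function.update_idem]
      simp only [Function.update_self, hik, if_true]
      rw [e1, e1]
      have e3 : (fun l => b l (i l)) =
          Function.update (fun l => b l (i l)) k (y + n * (2 * Real.pi)) := by
        rw [← hyn]
        conv_lhs => rw [← Function.update_eq_self k (fun l => b l (i l))]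
        simp [hik]
      conv_lhs => rw [e3, faceDiff_periodic hg hku]
      ring

/-- The mixed difference of `φ` with steps `h k`, `k ∈ u`. -/
def shiftDiff (φ : (Fin d → ℝ) → ℝ) (u : Finset (Fin d)) (h x : Fin d → ℝ) : ℝ :=
  ∑ s ∈ u.powerset, (-1 : ℝ) ^ (u \ s).card * φ (fun k => if k ∈ s then x k + h k else x k)

theorem shiftDiff_eq_faceDiff (φ : (Fin d → ℝ) → ℝ) (u : Finset (Fin d)) (h x : Fin d → ℝ) :
    shiftDiff φ u h x = faceDiff φ u x (fun k => if k ∈ u then x k + h k else x k) := by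
  refine Finset.sum_congr rfl fun s hs => ?_
  congr 2
  funext k
  have hs' := Finset.mem_powerset.1 hs
  by_cases hk : k ∈ s
  · simp [hk, hs' hk]
  · by_cases hu : k ∈ u
    · simp [hk, hu]
    · simp [hk, hu]

/-- Over the translates by a grid filling one period, the mixed differences of a function of bounded
Hardy-Krause variation have a bounded sum, uniformly in the grid. -/
theorem exists_sum_abs_shiftDiff_le (hg : TorusPeriodic g) (hb : BVHardyKrause g)
    (u : Finset (Fin d)) :
    ∃ C : ℝ, ∀ (x h : Fin d → ℝ) (m : Fin d → ℕ), (∀ k, 0 < m k) → (∀ k ∉ u, m k = 1) →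
      (∀ k, h k = 2 * Real.pi / m k) →
      ∑ i ∈ Fintype.piFinset (fun k => Finset.range (m k)),
        |shiftDiff g u h (x + fun k => i k * h k)| ≤ C := by
  have hpi := Real.pi_pos
  obtain ⟨C, hC⟩ := gridVar_bound hg hb Finset.univ u
  refine ⟨C, fun x h m hm hmu hh => ?_⟩
  have hpos : ∀ k, 0 < h k := fun k => by
    have : (0 : ℝ) < m k := by exact_mod_cast hm k
    rw [hh]; positivity
  -- The sequence stops after `m k` steps, that is after one period. It starts in some `[2πn, 2π(n +
  -- 1))`, so it stays in an interval of length `4π` as `AdmissibleGrid` demands. The common length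
  -- `∑ m + 1` below exceeds every `m k`.
  let p : Fin d → ℕ → ℝ := fun k i => x k + (min i (m k) : ℕ) * h k
  have hadm : AdmissibleGrid Finset.univ u p
      (fun k i => if k ∈ u then p k (i + 1) else x k) := by
    refine ⟨fun k hk => ⟨p k, ⌊x k / (2 * Real.pi)⌋, ?_, fun _ => rfl, by simp [hk], ?_, by simp⟩,
      by simp⟩
    · intro i j hij
      simp only [p]
      have : ((min i (m k) : ℕ) : ℝ) ≤ (min j (m k) : ℕ) := by
        exact_mod_cast min_le_min_right _ hij
      have := mul_le_mul_of_nonneg_right this (hpos k).le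
      linarith
    · intro i
      have h1 := Int.floor_le (x k / (2 * Real.pi))
      have h2 := Int.lt_floor_add_one (x k / (2 * Real.pi))
      rw [le_div_iff₀ (by positivity)] at h1
      rw [div_lt_iff₀ (by positivity)] at h2
      have h3 : (0 : ℝ) ≤ (min i (m k) : ℕ) * h k := mul_nonneg (by positivity) (hpos k).le
      have h4 : ((min i (m k) : ℕ) : ℝ) * h k ≤ 2 * Real.pi := by
        have e : (m k : ℝ) * h k = 2 * Real.pi := by
          have : (0 : ℝ) < m k := by exact_mod_cast hm k
          rw [hh]; field_simp
        rw [← e]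
        have : ((min i (m k) : ℕ) : ℝ) ≤ m k := by exact_mod_cast min_le_right _ _
        exact mul_le_mul_of_nonneg_right this (hpos k).le
      simp only [p]
      constructor <;> nlinarith
  refine le_trans ?_ (hC (∑ k, m k) _ _ hadm)
  have hsub : Fintype.piFinset (fun k => Finset.range (m k)) ⊆
      Fintype.piFinset (fun k => if k ∈ u then Finset.range (∑ k, m k + 1) else {0}) := by
    refine Fintype.piFinset_subset _ _ fun k => ?_
    by_cases hk : k ∈ u
    · simp only [hk, if_true]
      have := Finset.single_le_sum (f := m) (fun _ _ => Nat.zero_le _) (Finset.mem_univ k)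
      exact Finset.range_subset_range.2 (by omega)
    · simp [hk, hmu k hk]
  refine le_trans (le_of_eq ?_)
    (Finset.sum_le_sum_of_subset_of_nonneg hsub fun _ _ _ => abs_nonneg _)
  refine Finset.sum_congr rfl fun i hi => ?_
  rw [shiftDiff_eq_faceDiff]
  congr 1
  have him : ∀ k, i k < m k := fun k => by simpa using Fintype.mem_piFinset.1 hi k
  refine faceDiff_congr _ (fun k hk => ?_) (fun k => ?_)
  · simp only [p, Pi.add_apply]; rw [min_eq_left (him k).le]
  · by_cases hk : k ∈ u
    · simp only [hk, if_true, p, Pi.add_apply]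
      rw [min_eq_left (him k)]; push_cast; ring
    · have : i k = 0 := by have := him k; rw [hmu k hk] at this; omega
      simp [hk, this]

end

/-! ### Jumps of functions of bounded variation -/

section

/-- The jumps are the masses of the atoms of the Stieltjes measure, whose total mass on `(a, b]` is
finite. -/
theorem summable_jump_of_monotone {p : ℝ → ℝ} (hp : Monotone p) (a b : ℝ) :
    Summable fun α : Ioc a b => Function.rightLim p α - Function.leftLim p α := by
  let μ := hp.stieltjesFunction.measure.restrict (Ioc a b)
  have h1 : ∀ α : Ioc a b,
      μ {(α : ℝ)} = ENNReal.ofReal (Function.rightLim p α - Function.leftLim p α) := by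
    intro α
    have : ({(α : ℝ)} : Set ℝ) ∩ Ioc a b = {(α : ℝ)} :=
      inter_eq_left.2 (singleton_subset_iff.2 α.2)
    rw [Measure.restrict_apply (measurableSet_singleton _), this,
      StieltjesFunction.measure_singleton]
    have : Function.leftLim (hp.stieltjesFunction) α = Function.leftLim p α :=
      leftLim_rightLim (hp.tendsto_leftLim _)
    rw [this]; rfl
  have h2 : ∑' α : Ioc a b, μ {(α : ℝ)} ≤ μ univ :=
    tsum_measure_le_measure_univ (fun α => (measurableSet_singleton _).nullMeasurableSet)
      fun α β hαβ => by
        refine Disjoint.aedisjoint ?_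
        simpa [Subtype.ext_iff] using hαβ
  have h3 : μ univ < ⊤ := by
    simp only [μ, Measure.restrict_apply_univ, StieltjesFunction.measure_Ioc]
    exact ENNReal.ofReal_lt_top
  refine (ENNReal.summable_toReal (h2.trans_lt h3).ne).congr fun α => ?_
  rw [h1, ENNReal.toReal_ofReal]
  exact sub_nonneg.2 (hp.leftLim_le_rightLim le_rfl)

/-- Jordan decomposition, with both monotone parts extended to the line by constants. Only interior
points are covered: at an endpoint one of the one-sided limits depends on `φ` outside the interval.
-/
theorem summable_jump_of_boundedVariationOn {φ : ℝ → ℝ} {a b : ℝ} (hab : a ≤ b)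
    (hφ : BoundedVariationOn φ (Icc a b)) :
    Summable fun α : Ioo a b => Function.rightLim φ α - Function.leftLim φ α := by
  obtain ⟨p, q, hp, hq, rfl⟩ := hφ.locallyBoundedVariationOn.exists_monotoneOn_sub_monotoneOn
  have ext : ∀ {r : ℝ → ℝ}, MonotoneOn r (Icc a b) →
      ∃ R : ℝ → ℝ, Monotone R ∧ EqOn r R (Icc a b) := fun {r} hr => by
    refine ⟨IccExtend hab ((Icc a b).domRestrict r), Monotone.IccExtend _
      (fun x y hxy => hr x.2 y.2 hxy),
      fun x hx => ?_⟩
    rw [IccExtend_of_mem _ _ hx]; rfl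
  obtain ⟨P, hP, hpP⟩ := ext hp
  obtain ⟨Q, hQ, hqQ⟩ := ext hq
  have hinj : Function.Injective (fun α : Ioo a b => (⟨α, Ioo_subset_Ioc_self α.2⟩ : Ioc a b)) := by
    intro x y hxy
    simpa [Subtype.ext_iff] using hxy
  have hs := ((summable_jump_of_monotone hP a b).comp_injective hinj).sub
    ((summable_jump_of_monotone hQ a b).comp_injective hinj)
  refine hs.congr fun α => ?_
  have hev : ∀ᶠ t in 𝓝 (α : ℝ), (P - Q) t = (p - q) t := by
    filter_upwards [Icc_mem_nhds α.2.1 α.2.2] with t ht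
    simp [hpP ht, hqQ ht]
  have h1 : Function.rightLim (p - q) (α : ℝ) =
      Function.rightLim P α - Function.rightLim Q α :=
    rightLim_eq_of_tendsto (((hP.tendsto_rightLim _).sub (hQ.tendsto_rightLim _)).congr'
      (hev.filter_mono nhdsWithin_le_nhds))
  have h2 : Function.leftLim (p - q) (α : ℝ) =
      Function.leftLim P α - Function.leftLim Q α :=
    leftLim_eq_of_tendsto (((hP.tendsto_leftLim _).sub (hQ.tendsto_leftLim _)).congr'
      (hev.filter_mono nhdsWithin_le_nhds))
  rw [h1, h2]
  simp only [Function.comp]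
  ring

theorem _root_.Function.Periodic.rightLim {φ : ℝ → ℝ} {c : ℝ} (h : Function.Periodic φ c) :
    Function.Periodic (Function.rightLim φ) c := by
  intro t
  have hm : map (fun s => s + c) (𝓝[>] t) = 𝓝[>] (t + c) := by simp
  have key : ∀ y, Tendsto φ (𝓝[>] (t + c)) (𝓝 y) ↔ Tendsto φ (𝓝[>] t) (𝓝 y) := by
    intro y
    rw [← hm, tendsto_map'_iff]
    have : φ ∘ (fun s => s + c) = φ := funext h
    rw [this]
  by_cases hy : ∃ y, Tendsto φ (𝓝[>] t) (𝓝 y)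
  · obtain ⟨y, hy⟩ := hy
    rw [rightLim_eq_of_tendsto hy, rightLim_eq_of_tendsto ((key y).2 hy)]
  -- Without a limit, `rightLim` takes the value of the function, which is itself periodic.
  · rw [rightLim_eq_of_not_tendsto _ hy, rightLim_eq_of_not_tendsto, h]
    simpa only [key] using hy

theorem _root_.Function.Periodic.leftLim {φ : ℝ → ℝ} {c : ℝ} (h : Function.Periodic φ c) :
    Function.Periodic (Function.leftLim φ) c := by
  intro t
  have hm : map (fun s => s + c) (𝓝[<] t) = 𝓝[<] (t + c) := by simp
  have key : ∀ y, Tendsto φ (𝓝[<] (t + c)) (𝓝 y) ↔ Tendsto φ (𝓝[<] t) (𝓝 y) := by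
    intro y
    rw [← hm, tendsto_map'_iff]
    have : φ ∘ (fun s => s + c) = φ := funext h
    rw [this]
  by_cases hy : ∃ y, Tendsto φ (𝓝[<] t) (𝓝 y)
  · obtain ⟨y, hy⟩ := hy
    rw [leftLim_eq_of_tendsto hy, leftLim_eq_of_tendsto ((key y).2 hy)]
  · rw [leftLim_eq_of_not_tendsto _ hy, leftLim_eq_of_not_tendsto, h]
    simpa only [key] using hy

variable {d : ℕ} {f g : (Fin d → ℝ) → ℝ} {J : Fin d → ℝ → ℝ}

namespace HasHyperplaneJumps

theorem jump_eq_sub (hf : HasHyperplaneJumps f J) (j : Fin d) (t : ℝ) :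
    J j t = Function.rightLim (lineSection f j 0) t - Function.leftLim (lineSection f j 0) t := by
  have := hf.jump_eq j (Function.update 0 j t)
  simp only [jumpAt, Function.update_self] at this
  rw [← this]
  have e : lineSection f j (Function.update 0 j t) = lineSection f j 0 := by
    funext s; simp [lineSection]
  rw [e]

theorem jump_periodic (hf : HasHyperplaneJumps f J) (j : Fin d) :
    Function.Periodic (J j) (2 * Real.pi) := by
  intro t
  rw [hf.jump_eq_sub, hf.jump_eq_sub, (hf.periodic j 0).rightLim, (hf.periodic j 0).leftLim]

theorem summable_jump (hf : HasHyperplaneJumps f J) (j : Fin d) :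
    Summable ((Ioc 0 (2 * Real.pi)).indicator (J j)) := by
  have h := summable_jump_of_boundedVariationOn Real.two_pi_pos.le (hf.bv j 0)
  have h1 : Summable ((Ioo 0 (2 * Real.pi)).indicator (J j)) := by
    rw [← summable_subtype_iff_indicator]
    exact h.congr fun α => (hf.jump_eq_sub j α).symm
  -- The point `2π` is not interior to the interval of bounded variation, so its single jump is
  -- added by hand.
  have h2 : Summable (({2 * Real.pi} : Set ℝ).indicator (J j)) :=
    summable_of_hasFiniteSupport ((finite_singleton (2 * Real.pi)).subset support_indicator_subset)
  refine (h1.add h2).congr fun α => ?_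
  rw [← Ioo_union_right Real.two_pi_pos, indicator_union_of_disjoint]
  simp

theorem countable_jump_ne_zero (hf : HasHyperplaneJumps f J) (j : Fin d) :
    {t | J j t ≠ 0}.Countable := by
  have h := (hf.summable_jump j).countable_support
  refine (countable_iUnion fun n : ℤ => h.image fun t => t + n * (2 * Real.pi)).mono ?_
  intro t ht
  have h0 := toIocMod_mem_Ioc Real.two_pi_pos 0 t
  rw [zero_add] at h0
  have h1 := toIocMod_add_toIocDiv_zsmul Real.two_pi_pos 0 t
  rw [zsmul_eq_mul] at h1
  refine mem_iUnion.2 ⟨toIocDiv Real.two_pi_pos 0 t, toIocMod Real.two_pi_pos 0 t, ?_, h1⟩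
  rw [Function.mem_support, indicator_of_mem h0,
    ← (hf.jump_periodic j).int_mul (toIocDiv Real.two_pi_pos 0 t), h1]
  exact ht

end HasHyperplaneJumps

theorem sum_piFinset_singleton {M : Type*} [AddCommMonoid M] (j : Fin d) (N : ℕ)
    (F : (Fin d → ℕ) → M) :
    ∑ i ∈ Fintype.piFinset (fun k => if k ∈ ({j} : Finset (Fin d)) then Finset.range N else {0}),
      F i = ∑ i ∈ Finset.range N, F (Function.update 0 j i) := by
  refine Finset.sum_bij' (fun i _ => i j) (fun n _ => Function.update 0 j n) ?_ ?_ ?_ ?_ ?_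
  · intro i hi
    simpa using Fintype.mem_piFinset.1 hi j
  · intro n hn
    refine Fintype.mem_piFinset.2 fun k => ?_
    by_cases hk : k = j
    · subst hk; simpa using hn
    · simp [hk]
  · intro i hi
    funext k
    by_cases hk : k = j
    · subst hk; simp
    · have := Fintype.mem_piFinset.1 hi k
      simp only [Finset.mem_singleton, hk, if_false] at this
      simp [hk, this]
  · intro n hn; simp
  · intro i hi
    congr 1
    funext k
    by_cases hk : k = j
    · subst hk; simp
    · have := Fintype.mem_piFinset.1 hi k
      simp only [Finset.mem_singleton, hk, if_false] at this
      simp [hk, this]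

/-- For `u = ∅` the grid has a single cell and `gridVar` is `|g|` at the anchor, which is arbitrary
once all variables are released. -/
theorem exists_abs_le (hg : TorusPeriodic g) (hb : BVHardyKrause g) : ∃ C : ℝ, ∀ x, |g x| ≤ C := by
  obtain ⟨C, hC⟩ := gridVar_bound hg hb Finset.univ ∅
  refine ⟨C, fun x => ?_⟩
  have := hC 0 (fun _ _ => 0) (fun k _ => x k) ⟨by simp, by simp⟩
  have hs : Fintype.piFinset (fun k : Fin d =>
      if k ∈ (∅ : Finset (Fin d)) then Finset.range (0 + 1) else {0}) = {fun _ => 0} := by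
    ext i; simp [funext_iff]
  rwa [gridVar, hs, Finset.sum_singleton, faceDiff_empty] at this

theorem boundedVariationOn_lineSection (hg : TorusPeriodic g) (hb : BVHardyKrause g)
    (j : Fin d) (x : Fin d → ℝ) :
    BoundedVariationOn (lineSection g j x) (Icc 0 (2 * Real.pi)) := by
  obtain ⟨C, hC⟩ := gridVar_bound hg hb Finset.univ {j}
  refine ne_top_of_le_ne_top (ENNReal.ofReal_ne_top (r := C)) ?_
  refine iSup_le fun ⟨N, p, hp, hpi⟩ => ?_
  have h := hC N (fun _ => p) (fun k i => if k = j then p (i + 1) else x k)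
    ⟨fun k hk => ⟨p, 0, hp, fun _ => rfl, fun _ => if_pos (Finset.mem_singleton.1 hk),
      fun i => ?_, by simp⟩, by simp⟩
  · rw [gridVar, sum_piFinset_singleton] at h
    have h2 : ∑ i ∈ Finset.range N, |lineSection g j x (p (i + 1)) - lineSection g j x (p i)| ≤ C := by
      refine le_trans ?_ h
      refine le_trans (le_of_eq ?_) (Finset.sum_le_sum_of_subset_of_nonneg
        (Finset.range_mono (Nat.le_succ N)) fun _ _ _ => abs_nonneg _)
      refine Finset.sum_congr rfl fun i _ => ?_
      rw [faceDiff_eq_sub (Finset.mem_singleton_self j)]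
      have e : ({j} : Finset (Fin d)).erase j = ∅ := by simp
      rw [e, faceDiff_empty, faceDiff_empty]
      have e2 : ∀ t, Function.update (fun k => if k = j then
          p ((Function.update 0 j i : Fin d → ℕ) k + 1) else x k) j t = Function.update x j t := by
        intro t
        funext k
        by_cases hk : k = j
        · subst hk; simp
        · simp [hk]
      rw [e2, e2]
      simp [lineSection]
    calc ∑ i ∈ Finset.range N, edist (lineSection g j x (p (i + 1))) (lineSection g j x (p i))
        = ENNReal.ofReal (∑ i ∈ Finset.range N,
            |lineSection g j x (p (i + 1)) - lineSection g j x (p i)|) := by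
          rw [ENNReal.ofReal_sum_of_nonneg fun _ _ => abs_nonneg _]
          exact Finset.sum_congr rfl fun i _ => by rw [edist_dist, Real.dist_eq]
      _ ≤ ENNReal.ofReal C := ENNReal.ofReal_le_ofReal h2
  · have := hpi i
    simp only [mem_Icc] at this
    constructor <;> simp <;> linarith [Real.pi_pos]

theorem intervalIntegrable_lineSection (hg : TorusPeriodic g) (hb : BVHardyKrause g)
    (j : Fin d) (x : Fin d → ℝ) (a b : ℝ) :
    IntervalIntegrable (lineSection g j x) volume a b := by
  refine (hg j x).intervalIntegrable₀ Real.two_pi_pos.ne' ?_ a b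
  obtain ⟨p, q, hp, hq, h⟩ :=
    (boundedVariationOn_lineSection hg hb j x).locallyBoundedVariationOn
      |>.exists_monotoneOn_sub_monotoneOn
  rw [h]
  rw [← uIcc_of_le Real.two_pi_pos.le] at hp hq
  exact hp.intervalIntegrable.sub hq.intervalIntegrable

end

/-! ### The jump part of a function and its Fourier coefficients -/

section

/-- The `2π`-periodic sawtooth function with slope `-1/(2π)`, mean `0` and jump `1` at the
multiples of `2π`. -/
def sawtooth (t : ℝ) : ℝ := 1 / 2 - Int.fract (t / (2 * Real.pi))

theorem abs_sawtooth_le (t : ℝ) : |sawtooth t| ≤ 1 / 2 := by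
  have h1 := Int.fract_nonneg (t / (2 * Real.pi))
  have h2 := (Int.fract_lt_one (t / (2 * Real.pi))).le
  rw [sawtooth, abs_le]
  constructor <;> linarith

theorem sawtooth_periodic : Function.Periodic sawtooth (2 * Real.pi) := by
  intro t
  have : (t + 2 * Real.pi) / (2 * Real.pi) = t / (2 * Real.pi) + 1 := by
    rw [add_div, div_self Real.two_pi_pos.ne']
  rw [sawtooth, this, Int.fract_add_one, sawtooth]

theorem measurable_sawtooth : Measurable sawtooth := by
  unfold sawtooth
  fun_prop

/-- The periodic function with jumps `w α` at the points of `α + 2πℤ`, linear in between. -/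
def jumpPart (w : ℝ → ℝ) (t : ℝ) : ℝ := ∑' α, w α * sawtooth (t - α)

variable {w : ℝ → ℝ}

theorem abs_mul_sawtooth_le (α t : ℝ) : ‖w α * sawtooth t‖ ≤ ‖w α‖ * (1 / 2) := by
  rw [norm_mul]
  exact mul_le_mul_of_nonneg_left (abs_sawtooth_le t) (norm_nonneg _)

theorem summable_mul_sawtooth (hw : Summable w) (t : ℝ) :
    Summable fun α => w α * sawtooth (t - α) :=
  Summable.of_norm_bounded (hw.norm.mul_right _) fun α => abs_mul_sawtooth_le α _

theorem jumpPart_periodic (w : ℝ → ℝ) : Function.Periodic (jumpPart w) (2 * Real.pi) := by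
  intro t
  unfold jumpPart
  congr 1
  funext α
  rw [show t + 2 * Real.pi - α = t - α + 2 * Real.pi by ring, sawtooth_periodic]

theorem abs_jumpPart_le (hw : Summable w) (t : ℝ) : |jumpPart w t| ≤ (∑' α, ‖w α‖) * (1 / 2) := by
  rw [← tsum_mul_right]
  exact tsum_of_norm_bounded (hw.norm.mul_right _).hasSum fun α => abs_mul_sawtooth_le α _

/-- For summable `w` the support is countable, which is needed for measurability and for termwise
integration. -/
theorem jumpPart_eq_tsum_support (w : ℝ → ℝ) (t : ℝ) :
    jumpPart w t = ∑' α : Function.support w, w α * sawtooth (t - α) := by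
  unfold jumpPart
  rw [tsum_subtype (Function.support w) fun α => w α * sawtooth (t - α)]
  congr 1
  funext α
  by_cases h : α ∈ Function.support w
  · rw [indicator_of_mem h]
  · rw [indicator_of_notMem h, Function.notMem_support.1 h, zero_mul]

theorem measurable_jumpPart (hw : Summable w) : Measurable (jumpPart w) := by
  have : Countable (Function.support w) := hw.countable_support.to_subtype
  refine measurable_of_tendsto_metrizable' (ι := Finset (Function.support w)) atTop
    (f := fun s t => ∑ α ∈ s, w α * sawtooth (t - α)) (fun s => ?_) ?_
  · exact Finset.measurable_fun_sum _ fun α _ =>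
      (measurable_sawtooth.comp (measurable_id.sub_const _)).const_mul _
  · rw [tendsto_pi_nhds]
    intro t
    rw [jumpPart_eq_tsum_support]
    exact ((summable_mul_sawtooth hw t).subtype _).hasSum

/-- The sawtooth is right-continuous, so a jump at `α` is counted exactly when `a < α ≤ b`, the
convention of `IsPartialDeriv`. The other term is the drift of slope `-1/(2π)`. -/
theorem sawtooth_sub_sub_sawtooth_sub {a b α : ℝ} (ha : 0 ≤ a) (hab : a ≤ b)
    (hb : b ≤ 2 * Real.pi) (hα : α ∈ Ioc 0 (2 * Real.pi)) :
    sawtooth (b - α) - sawtooth (a - α) =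
      (Ioc a b).indicator 1 α - (b - a) / (2 * Real.pi) := by
  have hpi := Real.two_pi_pos
  have key : ∀ c : ℝ, 0 ≤ c → c ≤ 2 * Real.pi →
      sawtooth (c - α) = 1 / 2 - (c - α) / (2 * Real.pi) - if c < α then 1 else 0 := by
    intro c h0 h1
    have hα1 := hα.1
    have hα2 := hα.2
    split_ifs with h
    · have : ⌊(c - α) / (2 * Real.pi)⌋ = -1 := by
        rw [Int.floor_eq_iff]
        push_cast
        rw [le_div_iff₀ hpi, div_lt_iff₀ hpi]
        constructor <;> linarith
      rw [sawtooth, Int.fract, this]; push_cast; ring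
    · have : ⌊(c - α) / (2 * Real.pi)⌋ = 0 := by
        rw [Int.floor_eq_iff]
        push_cast
        rw [le_div_iff₀ hpi, div_lt_iff₀ hpi]
        constructor <;> linarith
      rw [sawtooth, Int.fract, this]; push_cast; ring
  rw [key b (ha.trans hab) hb, key a ha (hab.trans hb)]
  by_cases h1 : a < α
  · by_cases h2 : b < α
    · rw [indicator_of_notMem (by simp [h2])]; simp [h1, h2]; ring
    · rw [indicator_of_mem (show α ∈ Ioc a b from ⟨h1, not_lt.1 h2⟩)]; simp [h1, h2]; ring
  · have h2 : ¬ b < α := fun h => h1 (hab.trans_lt h)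
    rw [indicator_of_notMem (by simp [h1])]; simp [h1, h2]; ring

theorem jumpPart_sub (J : ℝ → ℝ) (hw : Summable ((Ioc 0 (2 * Real.pi)).indicator J)) {a b : ℝ}
    (ha : 0 ≤ a) (hab : a ≤ b) (hb : b ≤ 2 * Real.pi) :
    jumpPart ((Ioc 0 (2 * Real.pi)).indicator J) b -
      jumpPart ((Ioc 0 (2 * Real.pi)).indicator J) a =
      ∑' α : Ioc a b, J α -
        (b - a) * ((∑' α, (Ioc 0 (2 * Real.pi)).indicator J α) / (2 * Real.pi)) := by
  set w := (Ioc 0 (2 * Real.pi)).indicator J with hwdef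
  have hsub : Ioc a b ⊆ Ioc 0 (2 * Real.pi) := Ioc_subset_Ioc ha hb
  have hind : (Ioc a b).indicator w = (Ioc a b).indicator J := by
    rw [hwdef, indicator_indicator, inter_eq_left.2 hsub]
  rw [jumpPart, jumpPart, ← (summable_mul_sawtooth hw b).tsum_sub (summable_mul_sawtooth hw a),
    tsum_subtype (Ioc a b) J, ← hind]
  have e : ∀ α, w α * sawtooth (b - α) - w α * sawtooth (a - α) =
      (Ioc a b).indicator w α - w α * ((b - a) / (2 * Real.pi)) := by
    intro α
    by_cases hα : α ∈ Ioc 0 (2 * Real.pi)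
    · rw [← mul_sub, sawtooth_sub_sub_sawtooth_sub ha hab hb hα]
      by_cases h : α ∈ Ioc a b
      · rw [indicator_of_mem h, indicator_of_mem h]; simp; ring
      · rw [indicator_of_notMem h, indicator_of_notMem h]; ring
    · have h0 : w α = 0 := indicator_of_notMem hα _
      have h1 : α ∉ Ioc a b := fun h => hα (hsub h)
      rw [h0, indicator_of_notMem h1]; ring
  rw [tsum_congr e, (hw.indicator _).tsum_sub (hw.mul_right _), tsum_mul_right]
  ring

/-! ### Exponential sums and the Fourier coefficients of the jump part -/

/-- The exponential sum `∑_α w α e^{-imα}`. -/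
def expSum (w : ℝ → ℝ) (m : ℤ) : ℂ := ∑' α : ℝ, (w α : ℂ) * Complex.exp (-(Complex.I * m * α))

theorem exp_periodic (m : ℤ) :
    Function.Periodic (fun t : ℝ => Complex.exp (-(Complex.I * m * t))) (2 * Real.pi) := by
  intro t
  dsimp only
  have : -(Complex.I * m * ((t + 2 * Real.pi : ℝ) : ℂ)) =
      -(Complex.I * m * t) + (-m : ℤ) * (2 * Real.pi * Complex.I) := by
    push_cast; ring
  rw [this, Complex.exp_add, Complex.exp_int_mul_two_pi_mul_I, mul_one]

theorem norm_exp_neg_I_mul (m : ℤ) (t : ℝ) : ‖Complex.exp (-(Complex.I * m * t))‖ = 1 := by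
  have : -(Complex.I * m * t) = ((-(m * t) : ℝ) : ℂ) * Complex.I := by push_cast; ring
  rw [this, Complex.norm_exp_ofReal_mul_I]

theorem integral_exp_neg (m : ℤ) :
    ∫ t in (0 : ℝ)..2 * Real.pi, Complex.exp (-(Complex.I * m * t)) =
      if m = 0 then 2 * (Real.pi : ℂ) else 0 := by
  split_ifs with h
  · subst h; simp
  · have hc : -(Complex.I * m) ≠ 0 := by simp [h]
    have := integral_exp_mul_complex (a := 0) (b := 2 * Real.pi) hc
    simp only [neg_mul] at this
    rw [this]
    have h1 := exp_periodic m 0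
    simp only [zero_add] at h1
    rw [h1]; simp

theorem integral_sawtooth_mul_exp (m : ℤ) :
    ∫ t in (0 : ℝ)..2 * Real.pi, (sawtooth t : ℂ) * Complex.exp (-(Complex.I * m * t)) =
      if m = 0 then 0 else 1 / (Complex.I * m) := by
  have hpi := Real.two_pi_pos
  have hpiC : (2 * (Real.pi : ℂ)) ≠ 0 := by exact_mod_cast hpi.ne'
  have e : ∫ t in (0 : ℝ)..2 * Real.pi, (sawtooth t : ℂ) * Complex.exp (-(Complex.I * m * t)) =
      ∫ t in (0 : ℝ)..2 * Real.pi,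
        ((1 / 2 - t / (2 * Real.pi) : ℝ) : ℂ) * Complex.exp (-(Complex.I * m * t)) := by
    refine intervalIntegral.integral_congr_ae ?_
    have : ∀ᵐ t : ℝ, t ≠ 2 * Real.pi := by simp [ae_iff]
    filter_upwards [this] with t ht hmem
    rw [uIoc_of_le hpi.le] at hmem
    have hlt : t < 2 * Real.pi := lt_of_le_of_ne hmem.2 ht
    have : Int.fract (t / (2 * Real.pi)) = t / (2 * Real.pi) :=
      Int.fract_eq_self.2 ⟨div_nonneg hmem.1.le hpi.le, (div_lt_one hpi).2 hlt⟩
    rw [sawtooth, this]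
  rw [e]
  split_ifs with h
  · subst h
    simp only [Int.cast_zero, mul_zero, zero_mul, neg_zero, Complex.exp_zero, mul_one]
    rw [intervalIntegral.integral_ofReal]
    have : ∫ t in (0 : ℝ)..2 * Real.pi, (1 / 2 - t / (2 * Real.pi)) = 0 := by
      rw [intervalIntegral.integral_sub (by simp) (by
        exact (continuous_id.div_const _).intervalIntegrable _ _),
        intervalIntegral.integral_div (2 * Real.pi) (fun t : ℝ => t), integral_id,
        intervalIntegral.integral_const, smul_eq_mul]
      field_simp; ring
    rw [this]; simp
  · have hm : (m : ℂ) ≠ 0 := by exact_mod_cast h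
    have hc : -(Complex.I * m) ≠ 0 := by simp [h]
    -- An antiderivative found by integrating by parts once.
    let F : ℝ → ℂ := fun t => ((1 / 2 - t / (2 * Real.pi) : ℝ) : ℂ) *
      (Complex.exp (-(Complex.I * m * t)) / (-(Complex.I * m))) +
      1 / (2 * Real.pi) * (Complex.exp (-(Complex.I * m * t)) / (-(Complex.I * m)) ^ 2)
    have hF : ∀ t : ℝ, HasDerivAt F
        (((1 / 2 - t / (2 * Real.pi) : ℝ) : ℂ) * Complex.exp (-(Complex.I * m * t))) t := by
      intro t
      have hE : HasDerivAt (fun t : ℝ => Complex.exp (-(Complex.I * m * t)))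
          (Complex.exp (-(Complex.I * m * t)) * (-(Complex.I * m))) t := by
        have h1 : HasDerivAt (fun z : ℂ => Complex.exp (-(Complex.I * m * z)))
            (Complex.exp (-(Complex.I * m * t)) * (-(Complex.I * m))) (t : ℂ) := by
          refine HasDerivAt.cexp ?_
          have := (((hasDerivAt_id (t : ℂ)).const_mul (Complex.I * m))).neg
          rw [mul_one] at this
          exact this
        exact h1.comp_ofReal
      have hL : HasDerivAt (fun t : ℝ => ((1 / 2 - t / (2 * Real.pi) : ℝ) : ℂ))
          ((-(1 / (2 * Real.pi)) : ℝ) : ℂ) t := by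
        refine HasDerivAt.ofReal_comp ?_
        exact ((hasDerivAt_id t).div_const (2 * Real.pi)).const_sub (1 / 2)
      have := (hL.mul (hE.div_const (-(Complex.I * m)))).add
        ((hE.div_const ((-(Complex.I * m)) ^ 2)).const_mul (1 / (2 * (Real.pi : ℂ))))
      refine HasDerivAt.congr_deriv (f := F) this ?_
      have h2 : Complex.exp (-(Complex.I * m * t)) * (-(Complex.I * m)) / (-(Complex.I * m)) =
          Complex.exp (-(Complex.I * m * t)) := mul_div_cancel_right₀ _ hc
      have h3 : Complex.exp (-(Complex.I * m * t)) * (-(Complex.I * m)) / (-(Complex.I * m)) ^ 2 =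
          Complex.exp (-(Complex.I * m * t)) / (-(Complex.I * m)) := by
        rw [sq, mul_div_mul_right _ _ hc]
      rw [h2, h3]
      push_cast
      ring
    rw [intervalIntegral.integral_eq_sub_of_hasDerivAt (fun t _ => hF t)]
    · have h1 := exp_periodic m 0
      simp only [zero_add] at h1
      simp only [F]
      rw [h1]
      have hpi' : (Real.pi : ℂ) ≠ 0 := by exact_mod_cast Real.pi_pos.ne'
      simp
      field_simp
      ring
    · refine Continuous.intervalIntegrable ?_ _ _
      fun_prop

theorem integral_sawtooth_sub_mul_exp (m : ℤ) (α : ℝ) :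
    ∫ t in (0 : ℝ)..2 * Real.pi, (sawtooth (t - α) : ℂ) * Complex.exp (-(Complex.I * m * t)) =
      Complex.exp (-(Complex.I * m * α)) * if m = 0 then 0 else 1 / (Complex.I * m) := by
  let φ : ℝ → ℂ := fun t => (sawtooth t : ℂ) * Complex.exp (-(Complex.I * m * t))
  have hφ : Function.Periodic φ (2 * Real.pi) := fun t => by
    simp only [φ, sawtooth_periodic t]
    congr 1
    exact exp_periodic m t
  have e : ∀ t : ℝ, (sawtooth (t - α) : ℂ) * Complex.exp (-(Complex.I * m * t)) =
      Complex.exp (-(Complex.I * m * α)) * φ (t - α) := by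
    intro t
    simp only [φ]
    rw [mul_left_comm, ← Complex.exp_add]
    congr 2; push_cast; ring
  simp_rw [e]
  rw [intervalIntegral.integral_const_mul, intervalIntegral.integral_comp_sub_right φ α,
    ← integral_sawtooth_mul_exp]
  congr 1
  have := hφ.intervalIntegral_add_eq (0 - α) 0
  rw [zero_add] at this
  rw [← this]
  congr 1
  ring

/-- Termwise integration is allowed because the `α`-th term is at most `|w α| / 2` in modulus, which
is summable. -/
theorem integral_jumpPart_mul_exp (hw : Summable w) (m : ℤ) :
    ∫ t in (0 : ℝ)..2 * Real.pi, (jumpPart w t : ℂ) * Complex.exp (-(Complex.I * m * t)) =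
      expSum w m * if m = 0 then 0 else 1 / (Complex.I * m) := by
  have : Countable (Function.support w) := hw.countable_support.to_subtype
  let G : Function.support w → ℝ → ℂ := fun α t =>
    (w α : ℂ) * ((sawtooth (t - α) : ℂ) * Complex.exp (-(Complex.I * m * t)))
  have hGn : ∀ α t, ‖G α t‖ ≤ ‖w α‖ * (1 / 2) := by
    intro α t
    simp only [G]
    rw [norm_mul, norm_mul, norm_exp_neg_I_mul, mul_one, Complex.norm_real, Complex.norm_real]
    exact mul_le_mul_of_nonneg_left (abs_sawtooth_le _) (norm_nonneg _)
  have hGm : ∀ α, Measurable (G α) := by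
    intro α
    have h1 : Measurable fun t : ℝ => sawtooth (t - α) :=
      measurable_sawtooth.comp (measurable_id.sub_const _)
    simp only [G]
    fun_prop
  have hGi : ∀ α, Integrable (G α) (volume.restrict (Ioc 0 (2 * Real.pi))) := fun α =>
    Integrable.of_bound (hGm α).aestronglyMeasurable _ (Eventually.of_forall (hGn α))
  have hs : Summable fun α => ∫ t in Ioc 0 (2 * Real.pi), ‖G α t‖ := by
    refine Summable.of_nonneg_of_le (fun α => integral_nonneg fun t => norm_nonneg _) (fun α => ?_)
      (((hw.norm.subtype _).mul_right (1 / 2)).mul_right (2 * Real.pi))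
    refine (integral_mono (hGi α).norm (integrable_const _) (hGn α)).trans (le_of_eq ?_)
    simp [Real.pi_pos.le]
    ring
  have key := hasSum_integral_of_summable_integral_norm hGi hs
  have e1 : ∀ t, ∑' α, G α t = (jumpPart w t : ℂ) * Complex.exp (-(Complex.I * m * t)) := by
    intro t
    rw [jumpPart_eq_tsum_support, Complex.ofReal_tsum, ← tsum_mul_right]
    refine tsum_congr fun α => ?_
    simp only [G]; push_cast; ring
  simp_rw [e1] at key
  rw [intervalIntegral.integral_of_le Real.two_pi_pos.le, ← key.tsum_eq, expSum, ← tsum_mul_right]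
  have e2 : ∀ α : Function.support w, ∫ t in Ioc 0 (2 * Real.pi), G α t =
      (fun α : ℝ => (w α : ℂ) * Complex.exp (-(Complex.I * m * α)) *
        if m = 0 then 0 else 1 / (Complex.I * m)) α := by
    intro α
    rw [← intervalIntegral.integral_of_le Real.two_pi_pos.le]
    simp only [G]
    rw [intervalIntegral.integral_const_mul, integral_sawtooth_sub_mul_exp, ← mul_assoc]
  rw [tsum_congr e2]
  refine (tsum_subtype (Function.support w) fun α : ℝ => (w α : ℂ) *
    Complex.exp (-(Complex.I * m * α)) * if m = 0 then 0 else 1 / (Complex.I * m)).trans ?_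
  refine tsum_congr fun α => ?_
  by_cases h : α ∈ Function.support w
  · rw [indicator_of_mem h]
  · rw [indicator_of_notMem h, Function.notMem_support.1 h]; simp

/-- The Fourier coefficients of `jumpPart w`. -/
def jumpCoeff (w : ℝ → ℝ) (m : ℤ) : ℂ :=
  if m = 0 then 0 else expSum w m / (2 * Real.pi * Complex.I * m)

/-- The integral factors over the coordinates; a nonzero frequency in a direction other than `k`
gives a vanishing factor. -/
theorem fourierCoeffTorus_jumpPart {d : ℕ} (hw : Summable w) (k : Fin d) (ν : Fin d → ℤ) :
    fourierCoeffTorus (fun x => jumpPart w (x k)) ν =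
      if ∀ l, l ≠ k → ν l = 0 then jumpCoeff w (ν k) else 0 := by
  have hpiC : (2 * (Real.pi : ℂ)) ≠ 0 := by exact_mod_cast Real.two_pi_pos.ne'
  have e : ∀ x : Fin d → ℝ, (jumpPart w (x k) : ℂ) * character (-ν) x =
      ∏ l, (fun l (t : ℝ) => (if l = k then (jumpPart w t : ℂ) else 1) *
        Complex.exp (-(Complex.I * ν l * t))) l (x l) := by
    intro x
    rw [Finset.prod_mul_distrib, Finset.prod_ite_eq' Finset.univ k]
    simp only [Finset.mem_univ, if_true, character]
    rw [← Complex.exp_sum, Finset.mul_sum]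
    congr 2
    refine Finset.sum_congr rfl fun l _ => ?_
    simp only [Pi.neg_apply]; push_cast; ring
  have hbox : ∫ x in Icc (0 : Fin d → ℝ) (fun _ => 2 * Real.pi),
      (jumpPart w (x k) : ℂ) * character (-ν) x =
      ∏ l, ∫ t in (0 : ℝ)..2 * Real.pi, (if l = k then (jumpPart w t : ℂ) else 1) *
        Complex.exp (-(Complex.I * ν l * t)) := by
    simp_rw [e]
    rw [← pi_univ_Icc, volume_pi, Measure.restrict_pi_pi, integral_fintype_prod_eq_prod
      fun l (t : ℝ) => (if l = k then (jumpPart w t : ℂ) else 1) *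
        Complex.exp (-(Complex.I * ν l * t))]
    refine Finset.prod_congr rfl fun l _ => ?_
    rw [intervalIntegral.integral_of_le Real.two_pi_pos.le]
    exact integral_Icc_eq_integral_Ioc
  rw [fourierCoeffTorus, hbox, ← Finset.mul_prod_erase Finset.univ _ (Finset.mem_univ k)]
  have e1 : ∀ l ∈ Finset.univ.erase k, ∫ t in (0 : ℝ)..2 * Real.pi,
      (if l = k then (jumpPart w t : ℂ) else 1) * Complex.exp (-(Complex.I * ν l * t)) =
        if ν l = 0 then 2 * (Real.pi : ℂ) else 0 := by
    intro l hl
    simp only [Finset.ne_of_mem_erase hl, if_false, one_mul]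
    exact integral_exp_neg (ν l)
  rw [Finset.prod_congr rfl e1]
  simp only [if_true]
  rw [integral_jumpPart_mul_exp hw]
  by_cases h0 : ∀ l, l ≠ k → ν l = 0
  swap
  · rw [if_neg h0]
    push Not at h0
    obtain ⟨l, hl, hl0⟩ := h0
    rw [Finset.prod_eq_zero (i := l) (by simp [hl]) (by simp [hl0])]
    simp
  rw [if_pos h0]
  split_ifs with h
  · simp [jumpCoeff, h]
  · have hprod : ∏ l ∈ Finset.univ.erase k, (if ν l = 0 then 2 * (Real.pi : ℂ) else 0) =
        (2 * Real.pi) ^ (d - 1) := by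
      rw [Finset.prod_congr rfl fun l hl => if_pos (h0 l (Finset.ne_of_mem_erase hl))]
      simp
    have hd : (2 * (Real.pi : ℂ)) ^ d = (2 * Real.pi) ^ (d - 1) * (2 * Real.pi) := by
      rw [← pow_succ, Nat.sub_add_cancel k.pos]
    rw [hprod, hd, jumpCoeff, if_neg h]
    have hm : (ν k : ℂ) ≠ 0 := by exact_mod_cast h
    field_simp

end

/-! ### The regular part -/

section

variable {d : ℕ}

open scoped Pointwise in
-- Up to a null set the box is a fundamental domain of the lattice `2πℤ^d`, and so is each of its
-- translates; a lattice-invariant function has the same integral over both.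
theorem integral_box_add {E : Type*} [NormedAddCommGroup E] [NormedSpace ℝ E]
    (H : (Fin d → ℝ) → E) (hH : ∀ k x, H (x + Pi.single k (2 * Real.pi)) = H x) (v : Fin d → ℝ) :
    ∫ x in Icc (0 : Fin d → ℝ) (fun _ => 2 * Real.pi), H (x + v) =
      ∫ x in Icc (0 : Fin d → ℝ) (fun _ => 2 * Real.pi), H x := by
  have hpi := Real.two_pi_pos
  let w : Fin d → ℝ := fun _ => 2 * Real.pi
  have hw : ∀ i, IsUnit (w i) := fun i => isUnit_iff_ne_zero.2 hpi.ne'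
  let b := (Pi.basisFun ℝ (Fin d)).isUnitSMul hw
  have hbi : ∀ i, b i = Pi.single i (2 * Real.pi) := by
    intro i
    simp only [b, Module.Basis.isUnitSMul_apply, Pi.basisFun_apply, w]
    ext k
    by_cases hk : k = i
    · subst hk; simp
    · simp [hk]
  have hfd : ZSpan.fundamentalDomain b = univ.pi fun _ => Ico 0 (2 * Real.pi) := by
    ext x
    simp only [ZSpan.mem_fundamentalDomain, mem_univ_pi]
    refine forall_congr' fun i => ?_
    have : b.repr x i = x i / (2 * Real.pi) := by
      simp only [b, Module.Basis.repr_isUnitSMul, Pi.basisFun_repr]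
      rw [Units.smul_def, Units.val_inv_eq_inv_val, IsUnit.unit_spec, smul_eq_mul, inv_mul_eq_div]
    rw [this, mem_Ico, mem_Ico, div_lt_one hpi, le_div_iff₀ hpi, zero_mul]
  have hinv : ∀ (y : (Submodule.span ℤ (range b)).toAddSubgroup) (x : Fin d → ℝ), H (y +ᵥ x) = H x := by
    rintro ⟨y, hy⟩
    change ∀ x, H (y + x) = H x
    change y ∈ Submodule.span ℤ (range b) at hy
    induction hy using Submodule.span_induction with
    | mem y hy =>
      obtain ⟨i, rfl⟩ := hy
      intro x
      rw [hbi, add_comm, hH]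
    | zero => simp
    | add y z _ _ hy hz => intro x; rw [add_assoc, hy, hz]
    | smul a y _ hy =>
      have h1 : ∀ n : ℕ, ∀ x, H ((n : ℤ) • y + x) = H x := by
        intro n
        induction n with
        | zero => simp
        | succ n ih =>
          intro x
          rw [Nat.cast_succ, add_smul, one_smul, add_assoc, ih, hy]
      intro x
      obtain ⟨n, rfl | rfl⟩ := a.eq_nat_or_neg
      · exact h1 n x
      · rw [← h1 n, ← add_assoc, ← add_smul]; simp
  have hae : Icc (0 : Fin d → ℝ) (fun _ => 2 * Real.pi) =ᵐ[volume] ZSpan.fundamentalDomain b := by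
    rw [hfd, volume_pi]
    exact Measure.univ_pi_Ico_ae_eq_Icc.symm
  have : Countable (Submodule.span ℤ (range b)).toAddSubgroup :=
    inferInstanceAs (Countable (Submodule.span ℤ (range b)))
  have hF := ZSpan.isAddFundamentalDomain' b (volume : Measure (Fin d → ℝ))
  have hF2 : IsAddFundamentalDomain (Submodule.span ℤ (range b)).toAddSubgroup
      (v +ᵥ ZSpan.fundamentalDomain b) (volume : Measure (Fin d → ℝ)) := hF.vadd_of_comm v
  rw [setIntegral_congr_set hae, setIntegral_congr_set hae, hF.setIntegral_eq hF2 hinv,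
    ← (measurePreserving_add_right (volume : Measure (Fin d → ℝ)) v).setIntegral_preimage_emb
      (measurableEmbedding_addRight v) H]
  have : (fun x => x + v) ⁻¹' (v +ᵥ ZSpan.fundamentalDomain b) = ZSpan.fundamentalDomain b := by
    ext x
    rw [mem_preimage, mem_vadd_set_iff_neg_vadd_mem, vadd_eq_add, neg_add_cancel_comm_assoc]
  rw [this]

theorem TorusPeriodic.add_single {f : (Fin d → ℝ) → ℝ} (hf : TorusPeriodic f) (k : Fin d)
    (x : Fin d → ℝ) : f (x + Pi.single k (2 * Real.pi)) = f x := by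
  have h := hf k x (x k)
  simp only [lineSection, Function.update_eq_self] at h
  rw [← h]
  congr 1
  ext l
  by_cases hl : l = k
  · subst hl; simp
  · simp [hl]

variable {f : (Fin d → ℝ) → ℝ} {J : Fin d → ℝ → ℝ}

/-- The jumps in the direction `e_k` in one period. -/
def jumpWeight (J : Fin d → ℝ → ℝ) (k : Fin d) : ℝ → ℝ := (Ioc 0 (2 * Real.pi)).indicator (J k)

/-- The function `f` with its jumps removed. -/
def regularPart (f : (Fin d → ℝ) → ℝ) (J : Fin d → ℝ → ℝ) (x : Fin d → ℝ) : ℝ :=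
  f x - ∑ k, jumpPart (jumpWeight J k) (x k)

namespace HasHyperplaneJumps

theorem ae_jump_add_eq_zero (hf : HasHyperplaneJumps f J) (v : Fin d → ℝ) :
    ∀ᵐ x : Fin d → ℝ, ∀ k, J k (x k + v k) = 0 := by
  rw [ae_all_iff]
  intro k
  have h : {t | J k (t + v k) ≠ 0}.Countable :=
    (hf.countable_jump_ne_zero k).preimage (add_left_injective (v k))
  have h2 := h.ae_notMem volume
  rw [volume_pi]
  filter_upwards [Measure.tendsto_eval_ae_ae.eventually h2] with x hx
  simpa using hx

theorem regularPart_periodic (hf : HasHyperplaneJumps f J) : TorusPeriodic (regularPart f J) := by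
  intro j x t
  have h1 := hf.periodic j x t
  simp only [lineSection, regularPart] at h1 ⊢
  rw [h1]
  congr 1
  refine Finset.sum_congr rfl fun k _ => ?_
  by_cases hk : k = j
  · subst hk
    simp only [Function.update_self]
    exact jumpPart_periodic _ t
  · simp [hk]

/-- The increments in `IsPartialDeriv` concern one-sided limits, and the value of `f` at a jump is
not prescribed. Off the jump hyperplanes `f` is continuous and the limits are values; these
hyperplanes form a null set, so working off them is enough for Fourier coefficients. -/
theorem rightLim_lineSection (hf : HasHyperplaneJumps f J) {x : Fin d → ℝ}
    (hx : ∀ k, J k (x k) = 0) (j : Fin d) {t : ℝ} (ht : J j t = 0) :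
    Function.rightLim (lineSection f j x) t = f (Function.update x j t) := by
  have hc : ContinuousAt f (Function.update x j t) := by
    refine hf.continuousAt _ fun k => ?_
    by_cases hk : k = j
    · subst hk; simpa using ht
    · simpa [hk] using hx k
  have h2 : ContinuousAt (lineSection f j x) t :=
    ContinuousAt.comp (f := fun t => Function.update x j t) hc
      (continuous_const.update j continuous_id).continuousAt
  exact h2.continuousWithinAt.rightLim_eq

/-- Off the jumps, the regular part has the increments of an absolutely continuous function. -/
theorem regularPart_update_sub (hf : HasHyperplaneJumps f J) {j : Fin d} {g : (Fin d → ℝ) → ℝ}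
    (hg : TorusPeriodic g) (hgb : BVHardyKrause g) (hfg : IsPartialDeriv f (J j) j g)
    {x : Fin d → ℝ} (hx : ∀ k, J k (x k) = 0) {a b : ℝ} (ha : J j a = 0) (hb : J j b = 0) :
    regularPart f J (Function.update x j b) - regularPart f J (Function.update x j a) =
      ∫ t in a..b, (lineSection g j x t + (∑' α, jumpWeight J j α) / (2 * Real.pi)) := by
  have hpi := Real.two_pi_pos
  set c := (∑' α, jumpWeight J j α) / (2 * Real.pi) with hc
  have hint : ∀ a b, IntervalIntegrable (fun t => lineSection g j x t + c) volume a b := fun a b =>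
    (intervalIntegrable_lineSection hg hgb j x a b).add (by simp)
  have hsplit : ∀ a b, ∫ t in a..b, (lineSection g j x t + c) =
      (∫ t in a..b, lineSection g j x t) + (b - a) * c := by
    intro a b
    rw [intervalIntegral.integral_add (intervalIntegrable_lineSection hg hgb j x a b) (by simp)]
    simp
  have hsub : ∀ a b : ℝ, regularPart f J (Function.update x j b) -
      regularPart f J (Function.update x j a) =
      f (Function.update x j b) - f (Function.update x j a) -
        (jumpPart (jumpWeight J j) b - jumpPart (jumpWeight J j) a) := by
    intro a b
    have h : ∀ t : ℝ, ∑ k, jumpPart (jumpWeight J k) (Function.update x j t k) =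
        jumpPart (jumpWeight J j) t +
          ∑ k ∈ Finset.univ.erase j, jumpPart (jumpWeight J k) (x k) := by
      intro t
      rw [← Finset.add_sum_erase Finset.univ _ (Finset.mem_univ j)]
      congr 1
      · simp
      · refine Finset.sum_congr rfl fun k hk => ?_
        rw [Function.update_of_ne (Finset.ne_of_mem_erase hk)]
    simp only [regularPart]
    rw [h, h]; ring
  have local_eq : ∀ a b : ℝ, 0 ≤ a → a ≤ b → b ≤ 2 * Real.pi → J j a = 0 → J j b = 0 →
      regularPart f J (Function.update x j b) - regularPart f J (Function.update x j a) =
      ∫ t in a..b, (lineSection g j x t + c) := by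
    intro a b ha0 hab hb2 ha hb
    rw [hsub, hsplit]
    have h1 := hfg x a b hab
    rw [hf.rightLim_lineSection hx j ha, hf.rightLim_lineSection hx j hb] at h1
    have h2 := jumpPart_sub (J j) (hf.summable_jump j) ha0 hab hb2
    rw [h1]
    simp only [jumpWeight] at hc ⊢
    rw [h2, ← hc]; ring
  -- Over a full period `f` has no net increment, so the integral of `g` is minus the sum of the
  -- jumps, and `c` compensates it exactly.
  have hperiod : ∫ t in (0 : ℝ)..2 * Real.pi, (lineSection g j x t + c) = 0 := by
    have h1 := hfg x 0 (2 * Real.pi) hpi.le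
    have h2 := (hf.periodic j x).rightLim 0
    rw [zero_add] at h2
    rw [h2, sub_self, tsum_subtype] at h1
    rw [hsplit, hc, jumpWeight, sub_zero, mul_div_cancel₀ _ hpi.ne']
    exact h1.symm
  -- The identity says that `E` takes equal values at `a` and `b`. Within `[0, 2π]` this is
  -- `local_eq`; since `E` is periodic, all points off the jumps reduce to that interval.
  let E : ℝ → ℝ := fun t => regularPart f J (Function.update x j t) -
    ∫ s in (0 : ℝ)..t, (lineSection g j x s + c)
  have hE : Function.Periodic E (2 * Real.pi) := by
    intro t
    have h1 := hf.regularPart_periodic j x t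
    simp only [lineSection] at h1
    have h2 : Function.Periodic (fun t => lineSection g j x t + c) (2 * Real.pi) := fun t => by
      dsimp only; rw [hg j x t]
    have h3 := h2.intervalIntegral_add_eq t 0
    rw [zero_add, hperiod] at h3
    simp only [E]
    rw [h1, ← intervalIntegral.integral_add_adjacent_intervals (hint 0 t) (hint t _), h3, add_zero]
  have hloc : ∀ a b : ℝ, a ∈ Icc 0 (2 * Real.pi) → b ∈ Icc 0 (2 * Real.pi) → J j a = 0 →
      J j b = 0 → E a = E b := by
    intro a b ha0 hb0 ha hb
    wlog hab : a ≤ b generalizing a b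
    · exact (this b a hb0 ha0 hb ha (le_of_not_ge hab)).symm
    have h1 := local_eq a b ha0.1 hab hb0.2 ha hb
    have h2 := intervalIntegral.integral_add_adjacent_intervals (hint 0 a) (hint a b)
    simp only [E]
    rw [← h2, ← h1]; ring
  have hred : ∀ a, J j a = 0 → ∃ a' ∈ Icc 0 (2 * Real.pi), J j a' = 0 ∧ E a = E a' := by
    intro a ha
    have h0 := toIocMod_mem_Ioc hpi 0 a
    rw [zero_add] at h0
    have h1 := toIocMod_add_toIocDiv_zsmul hpi 0 a
    rw [zsmul_eq_mul] at h1
    refine ⟨toIocMod hpi 0 a, Ioc_subset_Icc_self h0, ?_, ?_⟩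
    · rw [← (hf.jump_periodic j).int_mul (toIocDiv hpi 0 a), h1, ha]
    · rw [← hE.int_mul (toIocDiv hpi 0 a) (toIocMod hpi 0 a), h1]
  obtain ⟨a', ha', hJa, hEa⟩ := hred a ha
  obtain ⟨b', hb', hJb, hEb⟩ := hred b hb
  have hEE : E a = E b := by rw [hEa, hEb, hloc a' b' ha' hb' hJa hJb]
  have h2 := intervalIntegral.integral_add_adjacent_intervals (hint 0 a) (hint a b)
  simp only [E] at hEE
  linarith

/-- A fixed point `z` off the jumps is reached from `x` by changing one coordinate at a time. By
periodicity each change can be made within one period, and it costs at most `2π` times a bound for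
`|g_j + c|`. -/
theorem exists_abs_regularPart_le (hf : HasHyperplaneJumps f J) :
    ∃ B : ℝ, ∀ x : Fin d → ℝ, (∀ k, J k (x k) = 0) → |regularPart f J x| ≤ B := by
  have hpi := Real.two_pi_pos
  choose g hg hgb hfg using hf.partial_bv
  have hstep : ∀ j, ∃ M : ℝ, ∀ x : Fin d → ℝ, (∀ k, J k (x k) = 0) → ∀ b, J j b = 0 →
      |regularPart f J x - regularPart f J (Function.update x j b)| ≤ M := by
    intro j
    obtain ⟨C, hC⟩ := exists_abs_le (hg j) (hgb j)
    set c := (∑' α, jumpWeight J j α) / (2 * Real.pi) with hc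
    refine ⟨(C + |c|) * (2 * Real.pi), fun x hx b hb => ?_⟩
    obtain ⟨a, n, ha, hxa⟩ : ∃ (a : ℝ) (n : ℤ), a ∈ Ico b (b + 2 * Real.pi) ∧
        a + n * (2 * Real.pi) = x j := by
      refine ⟨toIcoMod hpi b (x j), toIcoDiv hpi b (x j), toIcoMod_mem_Ico hpi b (x j), ?_⟩
      have := toIcoMod_add_toIcoDiv_zsmul hpi b (x j)
      rwa [zsmul_eq_mul] at this
    have h1 : regularPart f J x = regularPart f J (Function.update x j a) := by
      rw [← hf.regularPart_periodic.update_add j x a n, hxa, Function.update_eq_self]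
    have hJa : J j a = 0 := by
      rw [← (hf.jump_periodic j).int_mul n a, hxa, hx]
    rw [h1, hf.regularPart_update_sub (hg j) (hgb j) (hfg j) hx hb hJa, ← Real.norm_eq_abs]
    refine (intervalIntegral.norm_integral_le_of_norm_le_const (C := C + |c|) fun t _ => ?_).trans ?_
    · exact (abs_add_le _ _).trans (add_le_add (hC _) le_rfl)
    · have : 0 ≤ C + |c| := add_nonneg ((abs_nonneg _).trans (hC 0)) (abs_nonneg _)
      refine mul_le_mul_of_nonneg_left ?_ this
      rw [abs_of_nonneg (by linarith [ha.1])]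
      linarith [ha.2]
  choose M hM using hstep
  obtain ⟨z, hz⟩ : ∃ z : Fin d → ℝ, ∀ k, J k (z k) = 0 := by
    have : ∀ k, ∃ t, J k t = 0 := by
      intro k
      by_contra! h
      have : {t | J k t ≠ 0} = univ := by ext t; simp [h t]
      exact not_countable_univ (this ▸ hf.countable_jump_ne_zero k)
    choose z hz using this
    exact ⟨z, hz⟩
  refine ⟨|regularPart f J z| + ∑ k, M k, fun x hx => ?_⟩
  have key : ∀ s : Finset (Fin d), (∀ k, J k (s.piecewise z x k) = 0) ∧
      |regularPart f J x - regularPart f J (s.piecewise z x)| ≤ ∑ k ∈ s, M k := by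
    intro s
    induction s using Finset.induction_on with
    | empty => simpa using hx
    | insert k s hk ih =>
      rw [Finset.piecewise_insert]
      refine ⟨fun l => ?_, ?_⟩
      · by_cases hl : l = k
        · subst hl; simpa using hz l
        · simpa [hl] using ih.1 l
      · rw [Finset.sum_insert hk]
        have h1 := hM k _ ih.1 (z k) (hz k)
        calc _ = |(regularPart f J x - regularPart f J (s.piecewise z x)) +
              (regularPart f J (s.piecewise z x) -
                regularPart f J (Function.update (s.piecewise z x) k (z k)))| := by
                congr 1; ring
          _ ≤ _ := (abs_add_le _ _).trans (by linarith [ih.2])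
  have := (key Finset.univ).2
  rw [Finset.piecewise_univ] at this
  have h2 := abs_sub_abs_le_abs_sub (regularPart f J x) (regularPart f J z)
  linarith

/-- The set where all `J k (x k)` vanish is measurable and of full measure, and `f` is continuous at
each of its points. -/
theorem aestronglyMeasurable (hf : HasHyperplaneJumps f J) : AEStronglyMeasurable f volume := by
  let A : Set (Fin d → ℝ) := univ.pi fun k => {t | J k t ≠ 0}ᶜ
  have hA : MeasurableSet A :=
    MeasurableSet.univ_pi fun k => (hf.countable_jump_ne_zero k).measurableSet.compl
  have hmem : ∀ x, x ∈ A ↔ ∀ k, J k (x k) = 0 := by simp [A]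
  have hc : ContinuousOn f A := fun x hx =>
    (hf.continuousAt x ((hmem x).1 hx)).continuousWithinAt
  have h1 : (volume : Measure (Fin d → ℝ)).restrict A = volume := by
    refine Measure.restrict_eq_self_of_ae_mem ?_
    filter_upwards [hf.ae_jump_add_eq_zero 0] with x hx
    rw [hmem]
    simpa using hx
  rw [← h1]
  exact hc.aestronglyMeasurable hA

theorem measurable_jumpPart_eval (hf : HasHyperplaneJumps f J) (k : Fin d) :
    Measurable fun x : Fin d → ℝ => jumpPart (jumpWeight J k) (x k) :=
  (measurable_jumpPart (hf.summable_jump k)).comp (measurable_pi_apply k)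

theorem aestronglyMeasurable_regularPart (hf : HasHyperplaneJumps f J) :
    AEStronglyMeasurable (regularPart f J) volume :=
  hf.aestronglyMeasurable.sub (Finset.measurable_fun_sum _ fun k _ =>
    hf.measurable_jumpPart_eval k).aestronglyMeasurable

theorem integrableOn_regularPart_add (hf : HasHyperplaneJumps f J) (v : Fin d → ℝ) :
    IntegrableOn (fun x => regularPart f J (x + v))
      (Icc (0 : Fin d → ℝ) (fun _ => 2 * Real.pi)) := by
  obtain ⟨B, hB⟩ := hf.exists_abs_regularPart_le
  have : IsFiniteMeasure ((volume : Measure (Fin d → ℝ)).restrict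
      (Icc (0 : Fin d → ℝ) (fun _ => 2 * Real.pi))) :=
    ⟨by simpa using isCompact_Icc.measure_lt_top⟩
  refine Integrable.of_bound (C := B) ?_ ?_
  · exact (hf.aestronglyMeasurable_regularPart.comp_measurePreserving
      (measurePreserving_add_right volume v)).restrict
  · refine ae_restrict_of_ae ?_
    filter_upwards [hf.ae_jump_add_eq_zero v] with x hx
    exact hB _ hx

end HasHyperplaneJumps

/-! ### Characters and translations -/

theorem continuous_character (ν : Fin d → ℤ) : Continuous (character ν) := by
  unfold character
  fun_prop

theorem norm_character (ν : Fin d → ℤ) (x : Fin d → ℝ) : ‖character ν x‖ = 1 := by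
  have : Complex.I * ∑ k, (ν k : ℂ) * (x k : ℂ) =
      ((∑ k, (ν k : ℝ) * x k : ℝ) : ℂ) * Complex.I := by push_cast; ring
  rw [character, this, Complex.norm_exp_ofReal_mul_I]

theorem character_add (ν : Fin d → ℤ) (x y : Fin d → ℝ) :
    character ν (x + y) = character ν x * character ν y := by
  simp only [character, ← Complex.exp_add, ← mul_add, ← Finset.sum_add_distrib]
  congr 2
  refine Finset.sum_congr rfl fun k _ => ?_
  simp only [Pi.add_apply]; push_cast; ring

theorem character_neg_mul (ν : Fin d → ℤ) (x : Fin d → ℝ) :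
    character ν x * character (-ν) x = 1 := by
  simp only [character, ← Complex.exp_add, ← mul_add, ← Finset.sum_add_distrib]
  simp

theorem character_single (ν : Fin d → ℤ) (k : Fin d) (t : ℝ) :
    character ν (Pi.single k t) = Complex.exp (Complex.I * (ν k * t)) := by
  rw [character, Finset.sum_eq_single k]
  · simp
  · intro l _ hl; simp [hl]
  · simp

theorem integrableOn_mul_character {φ : (Fin d → ℝ) → ℝ} {s : Set (Fin d → ℝ)}
    (hφ : IntegrableOn φ s) (ν : Fin d → ℤ) :
    IntegrableOn (fun x => (φ x : ℂ) * character ν x) s :=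
  Integrable.mul_bdd (c := 1) hφ.ofReal (continuous_character ν).aestronglyMeasurable
    (Eventually.of_forall fun x => (norm_character ν x).le)

theorem integral_shift_mul_character {F : (Fin d → ℝ) → ℝ} (hF : TorusPeriodic F)
    (ν : Fin d → ℤ) (v : Fin d → ℝ) :
    ∫ x in Icc (0 : Fin d → ℝ) (fun _ => 2 * Real.pi), (F (x + v) : ℂ) * character (-ν) x =
      character ν v *
        ∫ x in Icc (0 : Fin d → ℝ) (fun _ => 2 * Real.pi), (F x : ℂ) * character (-ν) x := by
  rw [← integral_box_add (fun x => (F x : ℂ) * character (-ν) x) (fun k x => ?_) v,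
    ← integral_const_mul]
  · refine integral_congr_ae (Eventually.of_forall fun x => ?_)
    dsimp only
    rw [character_add]
    linear_combination (-(F (x + v) : ℂ) * character (-ν) x) * character_neg_mul ν v
  · rw [hF.add_single, character_add, character_single]
    have : Complex.I * (((-ν) k : ℤ) * ((2 * Real.pi : ℝ) : ℂ)) =
        ((-ν) k : ℤ) * (2 * Real.pi * Complex.I) := by push_cast; ring
    rw [this, Complex.exp_int_mul_two_pi_mul_I, mul_one]

end

/-! ### Decay of the Fourier coefficients of the regular part -/

section

variable {d : ℕ} {f : (Fin d → ℝ) → ℝ} {J : Fin d → ℝ → ℝ}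

/-- The vector with entries `h k` for `k ∈ s` and `0` otherwise. -/
def partialShift (s : Finset (Fin d)) (h : Fin d → ℝ) : Fin d → ℝ :=
  fun k => if k ∈ s then h k else 0

theorem shiftDiff_eq_sum_partialShift (φ : (Fin d → ℝ) → ℝ) (u : Finset (Fin d))
    (h x : Fin d → ℝ) :
    shiftDiff φ u h x =
      ∑ s ∈ u.powerset, (-1 : ℝ) ^ (u \ s).card * φ (x + partialShift s h) := by
  refine Finset.sum_congr rfl fun s _ => ?_
  congr 2
  funext k
  simp only [partialShift, Pi.add_apply]
  split_ifs <;> simp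

/-- This is `(1 - 1) ^ |u|`. It makes the drift constant `c` disappear from mixed differences. -/
theorem sum_powerset_neg_one_pow_card_sdiff {u : Finset (Fin d)} (hu : u.Nonempty) :
    ∑ s ∈ u.powerset, (-1 : ℝ) ^ (u \ s).card = 0 := by
  have := Finset.prod_add (fun _ => (1 : ℝ)) (fun _ => -1) u
  simp only [add_neg_cancel, Finset.prod_const, one_pow, one_mul] at this
  rw [← this, zero_pow (Finset.card_ne_zero.2 hu)]

theorem character_partialShift (ν : Fin d → ℤ) (s : Finset (Fin d)) (h : Fin d → ℝ) :
    character ν (partialShift s h) = ∏ k ∈ s, Complex.exp (Complex.I * (ν k * h k)) := by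
  rw [character, ← Complex.exp_sum, Finset.mul_sum]
  congr 1
  rw [← Finset.sum_subset (Finset.subset_univ s)]
  · refine Finset.sum_congr rfl fun k hk => ?_
    simp [partialShift, hk]
  · intro k _ hk; simp [partialShift, hk]

theorem intervalIntegrable_finsetSum {ι : Type*} (s : Finset ι) {φ : ι → ℝ → ℝ} {a b : ℝ}
    (h : ∀ i ∈ s, IntervalIntegrable (φ i) volume a b) :
    IntervalIntegrable (fun t => ∑ i ∈ s, φ i t) volume a b :=
  ⟨integrable_finsetSum s fun i hi => (h i hi).1, integrable_finsetSum s fun i hi => (h i hi).2⟩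

theorem intervalIntegrable_add_single {g : (Fin d → ℝ) → ℝ} (hg : TorusPeriodic g)
    (hgb : BVHardyKrause g) (j : Fin d) (y : Fin d → ℝ) (r : ℝ) :
    IntervalIntegrable (fun s => g (y + Pi.single j s)) volume 0 r := by
  have := (intervalIntegrable_lineSection hg hgb j y (y j + 0) (y j + r)).comp_add_left (y j)
  simp only [add_sub_cancel_left] at this
  refine this.congr (fun s _ => ?_)
  dsimp only [lineSection]
  congr 1
  ext k
  by_cases hk : k = j
  · subst hk; simp
  · simp [hk]

theorem intervalIntegrable_shiftDiff {g : (Fin d → ℝ) → ℝ} (hg : TorusPeriodic g)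
    (hgb : BVHardyKrause g) (j : Fin d) (u : Finset (Fin d)) (h y : Fin d → ℝ) (r : ℝ) :
    IntervalIntegrable (fun s => shiftDiff g u h (y + Pi.single j s)) volume 0 r := by
  simp_rw [shiftDiff_eq_sum_partialShift]
  refine intervalIntegrable_finsetSum _ fun s _ => IntervalIntegrable.const_mul ?_ _
  simp_rw [add_right_comm]
  exact intervalIntegrable_add_single hg hgb j _ r

/-- The number of grid cells in the direction `e_k` used for the frequency `ν`. -/
def gridSize (ν : Fin d → ℤ) (k : Fin d) : ℕ := if ν k = 0 then 1 else 2 * (ν k).natAbs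

/-- The grid step in the direction `e_k` used for the frequency `ν`. -/
def gridStep (ν : Fin d → ℤ) (k : Fin d) : ℝ := 2 * Real.pi / gridSize ν k

theorem gridSize_pos (ν : Fin d → ℤ) (k : Fin d) : 0 < gridSize ν k := by
  unfold gridSize
  split_ifs with h
  · exact one_pos
  · have := Int.natAbs_pos.2 h
    omega

theorem gridStep_pos (ν : Fin d → ℤ) (k : Fin d) : 0 < gridStep ν k :=
  div_pos Real.two_pi_pos (by exact_mod_cast gridSize_pos ν k)

/-- With `2|ν_k|` cells the step is `π / |ν_k|`, half a wavelength. Each shift then changes the sign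
of the character, and the terms of a mixed difference reinforce one another. -/
theorem exp_gridStep {ν : Fin d → ℤ} {k : Fin d} (hk : ν k ≠ 0) :
    Complex.exp (Complex.I * (ν k * gridStep ν k)) = -1 := by
  have hc : ((ν k : ℤ) : ℂ) ≠ 0 := by exact_mod_cast hk
  simp only [gridStep, gridSize, hk, if_false]
  rcases Int.natAbs_eq (ν k) with h | h
  · have h1 : (((ν k).natAbs : ℕ) : ℂ) = ν k := by
      conv_rhs => rw [h]
      simp
    push_cast
    rw [h1]
    have : Complex.I * (ν k * (2 * Real.pi / (2 * ν k))) = Real.pi * Complex.I := by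
      field_simp
    rw [this, Complex.exp_pi_mul_I]
  · have h1 : (((ν k).natAbs : ℕ) : ℂ) = -ν k := by
      conv_rhs => rw [h]
      simp
    push_cast
    rw [h1]
    have : Complex.I * (ν k * (2 * Real.pi / (2 * -ν k))) = -(Real.pi * Complex.I) := by
      field_simp
    rw [this, Complex.exp_neg, Complex.exp_pi_mul_I]; norm_num

namespace HasHyperplaneJumps

/-- The increment in direction `j` is the integral of `g + c`; the mixed difference passes under the
integral and kills `c`. The direction `j` may also belong to `u`, in which case it is differenced
twice. -/
theorem shiftDiff_regularPart (hf : HasHyperplaneJumps f J) {j : Fin d} {g : (Fin d → ℝ) → ℝ}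
    (hg : TorusPeriodic g) (hgb : BVHardyKrause g) (hfg : IsPartialDeriv f (J j) j g)
    {u : Finset (Fin d)} (hu : u.Nonempty) (h : Fin d → ℝ) {x : Fin d → ℝ}
    (hx : ∀ k, ∀ n : ℕ, J k (x k + n * h k) = 0) :
    shiftDiff (fun y => regularPart f J (y + Pi.single j (h j)) - regularPart f J y) u h x =
      ∫ s in (0 : ℝ)..h j, shiftDiff g u h (x + Pi.single j s) := by
  set c := (∑' α, jumpWeight J j α) / (2 * Real.pi) with hc
  have hupd : ∀ (y : Fin d → ℝ) (s : ℝ), y + Pi.single j s = Function.update y j (y j + s) := by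
    intro y s
    ext k
    by_cases hk : k = j
    · subst hk; simp
    · simp [hk]
  have hint : ∀ y : Fin d → ℝ,
      IntervalIntegrable (fun s => g (y + Pi.single j s)) volume 0 (h j) := fun y =>
    intervalIntegrable_add_single hg hgb j y (h j)
  have hterm : ∀ s ∈ u.powerset,
      regularPart f J (x + partialShift s h + Pi.single j (h j)) -
        regularPart f J (x + partialShift s h) =
      ∫ t in (0 : ℝ)..h j, (g (x + partialShift s h + Pi.single j t) + c) := by
    intro s _
    set y := x + partialShift s h with hy
    have hyn : ∀ k, ∃ n : ℕ, y k = x k + n * h k := by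
      intro k
      by_cases hk : k ∈ s
      · exact ⟨1, by simp [hy, partialShift, hk]⟩
      · exact ⟨0, by simp [hy, partialShift, hk]⟩
    have hy0 : ∀ k, J k (y k) = 0 := fun k => by
      obtain ⟨n, hn⟩ := hyn k
      rw [hn, hx]
    have hy1 : J j (y j + h j) = 0 := by
      obtain ⟨n, hn⟩ := hyn j
      rw [hn, ← hx j (n + 1)]; congr 1; push_cast; ring
    have h1 := hf.regularPart_update_sub hg hgb hfg hy0 (hy0 j) hy1
    rw [Function.update_eq_self] at h1
    rw [hupd, h1, ← hc]
    have h2 := intervalIntegral.integral_comp_add_left (a := 0) (b := h j)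
      (fun t => lineSection g j y t + c) (y j)
    rw [add_zero] at h2
    rw [← h2]
    refine intervalIntegral.integral_congr fun t _ => ?_
    simp [hupd, lineSection]
  rw [shiftDiff_eq_sum_partialShift]
  rw [Finset.sum_congr rfl fun s hs => by rw [hterm s hs]]
  simp_rw [← intervalIntegral.integral_const_mul]
  rw [← intervalIntegral.integral_finsetSum fun s _ => ((hint _).add (by simp)).const_mul _]
  refine intervalIntegral.integral_congr fun t _ => ?_
  simp_rw [mul_add]
  rw [Finset.sum_add_distrib, ← Finset.sum_mul, sum_powerset_neg_one_pow_card_sdiff hu, zero_mul,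
    add_zero, shiftDiff_eq_sum_partialShift]
  refine Finset.sum_congr rfl fun s _ => ?_
  rw [add_right_comm]

/-- The uniform bound for `g` is applied at `x + s e_j` and integrated over `0 ≤ s ≤ h j`. The
factor `h j` gained here is what makes the coefficients summable. -/
theorem sum_abs_shiftDiff_regularPart_le (hf : HasHyperplaneJumps f J) (j : Fin d)
    {u : Finset (Fin d)} (hu : u.Nonempty) :
    ∃ C : ℝ, 0 ≤ C ∧ ∀ (m : Fin d → ℕ) (h : Fin d → ℝ), (∀ k, 0 < m k) → (∀ k ∉ u, m k = 1) →
      (∀ k, h k = 2 * Real.pi / m k) →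
      ∀ x : Fin d → ℝ, (∀ k, ∀ n : ℕ, J k (x k + n * h k) = 0) →
      ∑ i ∈ Fintype.piFinset (fun k => Finset.range (m k)),
        |shiftDiff (fun y => regularPart f J (y + Pi.single j (h j)) - regularPart f J y) u h
          (x + fun k => i k * h k)| ≤ C * h j := by
  obtain ⟨g, hg, hgb, hfg⟩ := hf.partial_bv j
  obtain ⟨C, hC⟩ := exists_sum_abs_shiftDiff_le hg hgb u
  refine ⟨max C 0, le_max_right _ _, fun m h hm hmu hh x hx => ?_⟩
  have hpos : 0 ≤ h j := by
    have : (0 : ℝ) < m j := by exact_mod_cast hm j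
    have := Real.pi_pos
    rw [hh]; positivity
  have hint : ∀ y : Fin d → ℝ,
      IntervalIntegrable (fun s => shiftDiff g u h (y + Pi.single j s)) volume 0 (h j) := fun y =>
    intervalIntegrable_shiftDiff hg hgb j u h y (h j)
  set S := Fintype.piFinset fun k => Finset.range (m k)
  have h1 : ∀ i ∈ S, |shiftDiff (fun y => regularPart f J (y + Pi.single j (h j)) -
      regularPart f J y) u h (x + fun k => i k * h k)| ≤
      ∫ s in (0 : ℝ)..h j, |shiftDiff g u h ((x + fun k => i k * h k) + Pi.single j s)| := by
    intro i _
    have hxi : ∀ k, ∀ n : ℕ, J k ((x + fun k => i k * h k) k + n * h k) = 0 := by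
      intro k n
      refine (congrArg (J k) ?_).trans (hx k (i k + n))
      simp only [Pi.add_apply]; push_cast; ring
    rw [hf.shiftDiff_regularPart hg hgb hfg hu h hxi]
    exact intervalIntegral.abs_integral_le_integral_abs hpos
  refine (Finset.sum_le_sum h1).trans ?_
  rw [← intervalIntegral.integral_finsetSum fun i _ => (hint _).abs]
  have h2 : ∫ s in (0 : ℝ)..h j, max C 0 = max C 0 * h j := by simp [mul_comm]
  rw [← h2]
  refine intervalIntegral.integral_mono_on hpos
    (intervalIntegrable_finsetSum _ fun i _ => (hint _).abs) (by simp) fun s _ => ?_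
  refine (le_of_eq ?_).trans ((hC (x + Pi.single j s) h m hm hmu hh).trans (le_max_left _ _))
  refine Finset.sum_congr rfl fun i _ => ?_
  rw [add_right_comm]

theorem integral_shiftDiff_regularPart (hf : HasHyperplaneJumps f J) (ν : Fin d → ℤ) {j : Fin d}
    (hj : ν j ≠ 0) :
    ∫ x in Icc (0 : Fin d → ℝ) (fun _ => 2 * Real.pi),
      (shiftDiff (fun y => regularPart f J (y + Pi.single j (gridStep ν j)) - regularPart f J y)
        (Finset.univ.filter fun k => ν k ≠ 0) (gridStep ν) x : ℂ) * character (-ν) x =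
      (-2) ^ (Finset.univ.filter fun k => ν k ≠ 0).card * (-2) *
      ∫ x in Icc (0 : Fin d → ℝ) (fun _ => 2 * Real.pi),
        (regularPart f J x : ℂ) * character (-ν) x := by
  set u := Finset.univ.filter fun k => ν k ≠ 0 with hu
  set I := ∫ x in Icc (0 : Fin d → ℝ) (fun _ => 2 * Real.pi),
        (regularPart f J x : ℂ) * character (-ν) x with hI
  have e : ∀ x, (shiftDiff (fun y => regularPart f J (y + Pi.single j (gridStep ν j)) -
      regularPart f J y) u (gridStep ν) x : ℂ) * character (-ν) x =
      ∑ s ∈ u.powerset, (-1 : ℂ) ^ (u \ s).card *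
        ((regularPart f J (x + (partialShift s (gridStep ν) + Pi.single j (gridStep ν j))) : ℂ) *
          character (-ν) x -
        (regularPart f J (x + partialShift s (gridStep ν)) : ℂ) * character (-ν) x) := by
    intro x
    rw [shiftDiff_eq_sum_partialShift]
    push_cast
    rw [Finset.sum_mul]
    refine Finset.sum_congr rfl fun s _ => ?_
    rw [add_assoc]; ring
  have hint : ∀ v, IntegrableOn (fun x => (regularPart f J (x + v) : ℂ) * character (-ν) x)
      (Icc (0 : Fin d → ℝ) (fun _ => 2 * Real.pi)) := fun v =>
    integrableOn_mul_character (hf.integrableOn_regularPart_add v) _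
  simp_rw [e]
  rw [integral_finsetSum _ fun s _ => ((hint _).sub' (hint _)).const_mul _]
  -- The shift by `s` contributes `(-1)^|s|`, which together with `(-1)^|u \ s|` gives a sign
  -- independent of `s`; the increment in direction `j` contributes `-1 - 1`. All `2^|u|` terms are
  -- equal.
  have hterm : ∀ s ∈ u.powerset, ∫ x in Icc (0 : Fin d → ℝ) (fun _ => 2 * Real.pi),
      (-1 : ℂ) ^ (u \ s).card *
        ((regularPart f J (x + (partialShift s (gridStep ν) + Pi.single j (gridStep ν j))) : ℂ) *
          character (-ν) x -
        (regularPart f J (x + partialShift s (gridStep ν)) : ℂ) * character (-ν) x) =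
      (-1) ^ u.card * (-2) * I := by
    intro s hs
    have hs' := Finset.mem_powerset.1 hs
    rw [integral_const_mul, integral_sub (hint _) (hint _),
      integral_shift_mul_character hf.regularPart_periodic,
      integral_shift_mul_character hf.regularPart_periodic, character_add, character_partialShift,
      character_single, exp_gridStep hj]
    have hp : ∏ k ∈ s, Complex.exp (Complex.I * (ν k * gridStep ν k)) = (-1) ^ s.card := by
      rw [Finset.prod_congr rfl fun k hk => exp_gridStep (Finset.mem_filter.1 (hs' hk)).2]
      simp
    rw [hp, ← hI, ← Finset.card_sdiff_add_card_eq_card hs', pow_add]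
    ring
  rw [Finset.sum_congr rfl hterm, Finset.sum_const, Finset.card_powerset]
  have : (-2 : ℂ) ^ u.card = 2 ^ u.card * (-1) ^ u.card := by rw [← mul_pow]; norm_num
  rw [this, nsmul_eq_mul]
  push_cast
  ring

/-- The integral of `|Φ|` over the box is unchanged by translation, so it is the average over the
grid translates. The sum over translates is at most `C * h j` almost everywhere, and the number of
translates is the product of the grid sizes. -/
theorem norm_fourierCoeffTorus_regularPart_le_aux (hf : HasHyperplaneJumps f J) (j : Fin d)
    {u : Finset (Fin d)} (hu : u.Nonempty) :
    ∃ C : ℝ, 0 ≤ C ∧ ∀ ν : Fin d → ℤ, (Finset.univ.filter fun k => ν k ≠ 0) = u → ν j ≠ 0 →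
      ‖fourierCoeffTorus (regularPart f J) ν‖ ≤ C * gridStep ν j / ∏ k, (gridSize ν k : ℝ) := by
  have hpi := Real.two_pi_pos
  obtain ⟨C, hC0, hC⟩ := hf.sum_abs_shiftDiff_regularPart_le j hu
  refine ⟨C, hC0, fun ν hν hj => ?_⟩
  set box := Icc (0 : Fin d → ℝ) (fun _ => 2 * Real.pi) with hbox
  set F := regularPart f J
  set h := gridStep ν with hh
  let Φ : (Fin d → ℝ) → ℝ := shiftDiff (fun y => F (y + Pi.single j (h j)) - F y) u h
  have hΦ : ∀ x, Φ x = ∑ s ∈ u.powerset, (-1 : ℝ) ^ (u \ s).card *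
      (F (x + (partialShift s h + Pi.single j (h j))) - F (x + partialShift s h)) := by
    intro x
    simp only [Φ]
    rw [shiftDiff_eq_sum_partialShift]
    simp_rw [add_assoc]
  have hΦi : ∀ v, IntegrableOn (fun x => Φ (x + v)) box := by
    intro v
    simp_rw [hΦ, add_assoc]
    exact integrable_finsetSum _ fun s _ => ((hf.integrableOn_regularPart_add _).sub'
      (hf.integrableOn_regularPart_add _)).const_mul _
  have hΦp : ∀ k x, |Φ (x + Pi.single k (2 * Real.pi))| = |Φ x| := by
    intro k x
    rw [hΦ, hΦ]
    congr 1
    refine Finset.sum_congr rfl fun s _ => ?_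
    have hper : ∀ v, F (x + Pi.single k (2 * Real.pi) + v) = F (x + v) := fun v => by
      rw [add_right_comm]
      exact hf.regularPart_periodic.add_single k _
    rw [hper, hper]
  have hI := hf.integral_shiftDiff_regularPart ν hj
  rw [hν] at hI
  have h1 : ‖∫ x in box, (F x : ℂ) * character (-ν) x‖ ≤ ∫ x in box, |Φ x| := by
    have h2 : ‖∫ x in box, (Φ x : ℂ) * character (-ν) x‖ ≤ ∫ x in box, |Φ x| := by
      refine (norm_integral_le_integral_norm _).trans (le_of_eq ?_)
      refine integral_congr_ae (Eventually.of_forall fun x => ?_)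
      simp [norm_character]
    refine le_trans ?_ h2
    simp only [Φ]
    rw [hI, norm_mul, norm_mul, norm_pow]
    have h3 : (1 : ℝ) ≤ ‖(-2 : ℂ)‖ := by simp
    have h4 : (1 : ℝ) ≤ ‖(-2 : ℂ)‖ ^ u.card * ‖(-2 : ℂ)‖ :=
      one_le_mul_of_one_le_of_one_le (one_le_pow₀ h3) h3
    exact le_mul_of_one_le_left (norm_nonneg _) h4
  have hM : (0 : ℝ) < ∏ k, (gridSize ν k : ℝ) :=
    Finset.prod_pos fun k _ => by exact_mod_cast gridSize_pos ν k
  have hvol : (volume : Measure (Fin d → ℝ)).real box = (2 * Real.pi) ^ d := by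
    rw [hbox, Measure.real, Real.volume_Icc_pi]
    simp [ENNReal.toReal_ofReal, Real.pi_pos.le]
  have hfin : (volume : Measure (Fin d → ℝ)) box ≠ ⊤ := isCompact_Icc.measure_lt_top.ne
  have hae : ∀ᵐ x : Fin d → ℝ, ∀ k, ∀ n : ℕ, J k (x k + n * h k) = 0 := by
    have : ∀ᵐ x : Fin d → ℝ, ∀ n : ℕ, ∀ k, J k (x k + n * h k) = 0 := by
      rw [ae_all_iff]
      intro n
      exact hf.ae_jump_add_eq_zero fun k => n * h k
    filter_upwards [this] with x hx k n using hx n k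
  have h2 : (∏ k, (gridSize ν k : ℝ)) * ∫ x in box, |Φ x| ≤ C * h j * (2 * Real.pi) ^ d := by
    calc (∏ k, (gridSize ν k : ℝ)) * ∫ x in box, |Φ x|
        = ∑ i ∈ Fintype.piFinset (fun k => Finset.range (gridSize ν k)),
            ∫ x in box, |Φ (x + fun k => i k * h k)| := by
          simp_rw [hbox, integral_box_add (fun x => |Φ x|) hΦp]
          rw [Finset.sum_const, Fintype.card_piFinset, nsmul_eq_mul]
          simp
      _ = ∫ x in box, ∑ i ∈ Fintype.piFinset (fun k => Finset.range (gridSize ν k)),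
            |Φ (x + fun k => i k * h k)| := by
          rw [integral_finsetSum _ fun i _ => (hΦi _).abs]
      _ ≤ ∫ x in box, C * h j := by
          refine integral_mono_ae (integrable_finsetSum _ fun i _ => (hΦi _).abs)
            (integrableOn_const hfin) (ae_restrict_of_ae ?_)
          filter_upwards [hae] with x hx
          refine hC (gridSize ν) h (gridSize_pos ν) (fun k hk => ?_) (fun _ => rfl) x hx
          rw [← hν] at hk
          simp only [Finset.mem_filter, Finset.mem_univ, true_and, not_not] at hk
          simp [gridSize, hk]
      _ = C * h j * (2 * Real.pi) ^ d := by
          rw [setIntegral_const, hvol, smul_eq_mul, mul_comm]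
  have h3 : (∏ k, (gridSize ν k : ℝ)) * ‖∫ x in box, (F x : ℂ) * character (-ν) x‖ ≤
      C * h j * (2 * Real.pi) ^ d := (mul_le_mul_of_nonneg_left h1 hM.le).trans h2
  rw [fourierCoeffTorus, norm_mul, norm_div, norm_one, norm_pow, le_div_iff₀ hM]
  have h4 : ‖(2 * (Real.pi : ℂ))‖ = 2 * Real.pi := by
    simp [abs_of_pos Real.pi_pos]
  rw [h4, one_div, mul_assoc, inv_mul_le_iff₀ (by positivity), mul_comm _ (∏ k, (gridSize ν k : ℝ)),
    mul_comm ((2 * Real.pi) ^ d)]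
  exact h3

/-- The Fourier coefficients of the regular part decay like those of a function whose partial
derivatives have bounded Hardy-Krause variation. -/
theorem norm_fourierCoeffTorus_regularPart_le (hf : HasHyperplaneJumps f J) :
    ∃ C : ℝ, 0 ≤ C ∧ ∀ (ν : Fin d → ℤ) (j : Fin d), ν j ≠ 0 →
      ‖fourierCoeffTorus (regularPart f J) ν‖ ≤
        C / (|(ν j : ℝ)| * ∏ k, max 1 |(ν k : ℝ)|) := by
  have hpi := Real.pi_pos
  have h : ∀ (j : Fin d) (u : Finset (Fin d)), ∃ C : ℝ, 0 ≤ C ∧ ∀ ν : Fin d → ℤ,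
      (Finset.univ.filter fun k => ν k ≠ 0) = u → ν j ≠ 0 →
      ‖fourierCoeffTorus (regularPart f J) ν‖ ≤ C * gridStep ν j / ∏ k, (gridSize ν k : ℝ) := by
    intro j u
    rcases u.eq_empty_or_nonempty with rfl | hu
    · refine ⟨0, le_rfl, fun ν hν hj => ?_⟩
      have : j ∈ (Finset.univ.filter fun k => ν k ≠ 0) := by simp [hj]
      simp [hν] at this
    · exact hf.norm_fourierCoeffTorus_regularPart_le_aux j hu
  choose C hC0 hC using h
  -- The previous constants depend only on `j` and the support of `ν`, finitely many cases, so they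
  -- are added up. The factor `π` comes from the step `π / |ν_j|`.
  refine ⟨(∑ j, ∑ u, C j u) * Real.pi, mul_nonneg
    (Finset.sum_nonneg fun j _ => Finset.sum_nonneg fun u _ => hC0 j u) hpi.le, fun ν j hj => ?_⟩
  set u := (Finset.univ.filter fun k => ν k ≠ 0) with hu
  have h1 : C j u ≤ ∑ j, ∑ u, C j u :=
    (Finset.single_le_sum (f := C j) (fun u _ => hC0 j u) (Finset.mem_univ u)).trans
      (Finset.single_le_sum (f := fun j => ∑ u, C j u)
        (fun j _ => Finset.sum_nonneg fun u _ => hC0 j u) (Finset.mem_univ j))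
  have habs : ∀ k, ((ν k).natAbs : ℝ) = |(ν k : ℝ)| := fun k => by
    rw [Nat.cast_natAbs, Int.cast_abs]
  have hjpos : 0 < |(ν j : ℝ)| := abs_pos.2 (by exact_mod_cast hj)
  have h2 : gridStep ν j = Real.pi / |(ν j : ℝ)| := by
    rw [gridStep, gridSize, if_neg hj]
    push_cast
    rw [habs, mul_div_mul_left _ _ two_ne_zero]
  have h3 : ∏ k, max 1 |(ν k : ℝ)| ≤ ∏ k, (gridSize ν k : ℝ) := by
    refine Finset.prod_le_prod (fun k _ => by positivity) fun k _ => ?_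
    unfold gridSize
    split_ifs with h0
    · simp [h0]
    · have : (1 : ℝ) ≤ (ν k).natAbs := by exact_mod_cast Int.natAbs_pos.2 h0
      rw [← habs]
      push_cast
      rw [← Int.cast_abs, ← Nat.cast_natAbs] at *
      refine max_le ?_ ?_ <;> linarith
  have hP : 0 < ∏ k, max 1 |(ν k : ℝ)| := Finset.prod_pos fun k _ => by positivity
  calc _ ≤ C j u * gridStep ν j / ∏ k, (gridSize ν k : ℝ) := hC j u ν rfl hj
    _ ≤ (∑ j, ∑ u, C j u) * gridStep ν j / ∏ k, max 1 |(ν k : ℝ)| := by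
        have := (gridStep_pos ν j).le
        have := (hC0 j u).trans h1
        gcongr
    _ = _ := by
        rw [h2]; field_simp

end HasHyperplaneJumps

end

/-! ### Logarithmic means -/

section

/-- The logarithmic average `(log n)⁻¹ ∑_{m=1}^n a_m / m`. -/
def logAvg (a : ℕ → ℂ) (n : ℕ) : ℂ :=
  (∑ m ∈ Finset.range n, a (m + 1) / ((m : ℂ) + 1)) / (Real.log n : ℂ)

/-- The sequence `a` has the logarithmic mean `L`. -/
def HasLogMean (a : ℕ → ℂ) (L : ℂ) : Prop := Tendsto (logAvg a) atTop (𝓝 L)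

theorem HasLogMean.add {a b : ℕ → ℂ} {L M : ℂ} (ha : HasLogMean a L) (hb : HasLogMean b M) :
    HasLogMean (fun m => a m + b m) (L + M) := by
  refine (Tendsto.add ha hb).congr fun n => ?_
  simp only [logAvg, add_div, Finset.sum_add_distrib]

theorem HasLogMean.const_mul {a : ℕ → ℂ} {L : ℂ} (c : ℂ) (ha : HasLogMean a L) :
    HasLogMean (fun m => c * a m) (c * L) := by
  refine (Tendsto.const_mul c ha).congr fun n => ?_
  simp only [logAvg, mul_div_assoc, ← Finset.mul_sum]

theorem HasLogMean.finsetSum {ι : Type*} (s : Finset ι) {a : ι → ℕ → ℂ} {L : ι → ℂ}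
    (h : ∀ i ∈ s, HasLogMean (a i) (L i)) :
    HasLogMean (fun m => ∑ i ∈ s, a i m) (∑ i ∈ s, L i) := by
  refine (tendsto_finsetSum s h).congr fun n => ?_
  simp only [logAvg, Finset.sum_div]
  rw [Finset.sum_comm]

theorem tendsto_log_natCast : Tendsto (fun n : ℕ => Real.log n) atTop atTop :=
  Real.tendsto_log_atTop.comp tendsto_natCast_atTop_atTop

theorem sum_one_div_eq_harmonic (n : ℕ) :
    ∑ m ∈ Finset.range n, 1 / ((m : ℝ) + 1) = (harmonic n : ℝ) := by
  simp [harmonic]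

theorem tendsto_harmonic_div_log :
    Tendsto (fun n : ℕ => (harmonic n : ℝ) / Real.log n) atTop (𝓝 1) := by
  have h := (Real.tendsto_harmonic_sub_log.div_atTop tendsto_log_natCast).add_const 1
  rw [zero_add] at h
  refine h.congr' ?_
  filter_upwards [tendsto_log_natCast.eventually_gt_atTop 0] with n hn
  field_simp
  ring

/-- For `z = 1` this is the growth of the harmonic numbers. Otherwise the partial sums of the powers
are bounded, `∑ z^m / m` converges by Dirichlet's test, and division by `log n` gives `0`. -/
theorem hasLogMean_pow {z : ℂ} (hz : ‖z‖ = 1) :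
    HasLogMean (fun m => z ^ m) (if z = 1 then 1 else 0) := by
  split_ifs with h
  · subst h
    have h1 : Tendsto (fun n : ℕ => (((harmonic n : ℝ) / Real.log n : ℝ) : ℂ)) atTop (𝓝 1) := by
      have := (Complex.continuous_ofReal.tendsto 1).comp tendsto_harmonic_div_log
      rw [Complex.ofReal_one] at this
      exact this
    refine h1.congr fun n => ?_
    rw [logAvg, ← sum_one_div_eq_harmonic]
    push_cast
    simp
  · have hb : ∀ n, ‖∑ i ∈ Finset.range n, z ^ (i + 1)‖ ≤ 2 / ‖z - 1‖ := by
      intro n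
      simp_rw [pow_succ]
      rw [← Finset.sum_mul, norm_mul, hz, mul_one, geom_sum_eq h, norm_div]
      gcongr
      refine (norm_sub_le _ _).trans ?_
      rw [norm_pow, hz]; norm_num
    have hanti : Antitone fun m : ℕ => 1 / ((m : ℝ) + 1) := by
      intro m n hmn
      have : (m : ℝ) ≤ n := by exact_mod_cast hmn
      dsimp only
      gcongr
    have hc := hanti.cauchySeq_series_mul_of_tendsto_zero_of_bounded
      tendsto_one_div_add_atTop_nhds_zero_nat hb
    obtain ⟨l, hl⟩ := cauchySeq_tendsto_of_complete hc
    have hlog : Tendsto (fun n : ℕ => ((Real.log n : ℝ) : ℂ)⁻¹) atTop (𝓝 0) := by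
      have := (Complex.continuous_ofReal.tendsto 0).comp
        (tendsto_inv_atTop_zero.comp tendsto_log_natCast)
      refine (by simpa only [Complex.ofReal_zero] using this : Tendsto _ _ _).congr fun n => ?_
      simp
    have := hl.mul hlog
    rw [mul_zero] at this
    refine this.congr fun n => ?_
    rw [logAvg, div_eq_mul_inv]
    congr 1
    refine Finset.sum_congr rfl fun m _ => ?_
    rw [Complex.real_smul]; push_cast; ring

theorem norm_logAvg_le {a : ℕ → ℂ} {B : ℝ} (ha : ∀ m, ‖a m‖ ≤ B) {n : ℕ}
    (hn : 1 ≤ Real.log n) : ‖logAvg a n‖ ≤ 2 * B := by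
  have hB : 0 ≤ B := (norm_nonneg _).trans (ha 0)
  have hpos : 0 < Real.log n := by linarith
  rw [logAvg, norm_div, Complex.norm_real, Real.norm_eq_abs, abs_of_pos hpos, div_le_iff₀ hpos]
  calc ‖∑ m ∈ Finset.range n, a (m + 1) / ((m : ℂ) + 1)‖
      ≤ ∑ m ∈ Finset.range n, B * (1 / ((m : ℝ) + 1)) := by
        refine norm_sum_le_of_le _ fun m _ => ?_
        have : ‖(m : ℂ) + 1‖ = (m : ℝ) + 1 := by
          rw [← Nat.cast_succ, Complex.norm_natCast]; push_cast; ring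
        rw [norm_div, this, mul_one_div]
        have := ha (m + 1)
        gcongr
    _ = B * (harmonic n : ℝ) := by rw [← Finset.mul_sum, sum_one_div_eq_harmonic]
    _ ≤ B * (1 + Real.log n) := mul_le_mul_of_nonneg_left (harmonic_le_one_add_log n) hB
    _ ≤ 2 * B * Real.log n := by nlinarith

theorem logAvg_sub (a b : ℕ → ℂ) (n : ℕ) :
    logAvg (fun m => a m - b m) n = logAvg a n - logAvg b n := by
  simp only [logAvg, sub_div, Finset.sum_sub_distrib]

/-- Uniform approximation passes to logarithmic averages up to the factor `2` of `norm_logAvg_le`,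
so the averages of `a` form a Cauchy sequence. -/
theorem exists_hasLogMean_of_approx {a : ℕ → ℂ}
    (h : ∀ ε > 0, ∃ (b : ℕ → ℂ) (L : ℂ), HasLogMean b L ∧ ∀ m, ‖a m - b m‖ ≤ ε) :
    ∃ L, HasLogMean a L := by
  refine cauchySeq_tendsto_of_complete (Metric.cauchySeq_iff'.2 fun ε hε => ?_)
  obtain ⟨b, L, hb, hab⟩ := h (ε / 8) (by positivity)
  obtain ⟨N₁, hN₁⟩ := Metric.cauchySeq_iff.1 (Tendsto.cauchySeq hb) (ε / 4) (by positivity)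
  obtain ⟨N₂, hN₂⟩ := eventually_atTop.1 (tendsto_log_natCast.eventually_ge_atTop 1)
  refine ⟨max N₁ N₂, fun n hn => ?_⟩
  have key : ∀ k ≥ max N₁ N₂, ‖logAvg a k - logAvg b k‖ ≤ ε / 4 := fun k hk => by
    rw [← logAvg_sub]
    refine (norm_logAvg_le hab (hN₂ k (le_of_max_le_right hk))).trans (by linarith)
  have h1 := key n hn
  have h2 := key _ le_rfl
  have h3 := hN₁ n (le_of_max_le_left hn) (max N₁ N₂) (le_max_left _ _)
  rw [dist_eq_norm] at h3 ⊢
  calc ‖logAvg a n - logAvg a (max N₁ N₂)‖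
      = ‖(logAvg a n - logAvg b n) + (logAvg b n - logAvg b (max N₁ N₂)) -
          (logAvg a (max N₁ N₂) - logAvg b (max N₁ N₂))‖ := by congr 1; ring
    _ ≤ ‖logAvg a n - logAvg b n‖ + ‖logAvg b n - logAvg b (max N₁ N₂)‖ +
          ‖logAvg a (max N₁ N₂) - logAvg b (max N₁ N₂)‖ :=
        (norm_sub_le _ _).trans (by gcongr; exact norm_add_le _ _)
    _ < ε := by linarith

/-- Dominated convergence for series: the averages of each character are at most `2` once `log n ≥
1`. -/
theorem hasLogMean_tsum {ι : Type*} {c z : ι → ℂ} (hc : Summable fun i => ‖c i‖)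
    (hz : ∀ i, ‖z i‖ = 1) :
    HasLogMean (fun m => ∑' i, c i * z i ^ m) (∑' i, c i * if z i = 1 then 1 else 0) := by
  have hs : ∀ m : ℕ, Summable fun i => c i * z i ^ m := fun m =>
    Summable.of_norm (hc.congr fun i => by rw [norm_mul, norm_pow, hz, one_pow, mul_one])
  have e : ∀ n, logAvg (fun m => ∑' i, c i * z i ^ m) n =
      ∑' i, c i * logAvg (fun m => z i ^ m) n := by
    intro n
    simp only [logAvg, ← mul_div_assoc, tsum_div_const]
    congr 1
    simp_rw [Finset.mul_sum, ← tsum_div_const, ← mul_div_assoc]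
    rw [Summable.tsum_finsetSum fun m _ => (hs (m + 1)).div_const _]
  rw [HasLogMean, funext e]
  refine tendsto_tsum_of_dominated_convergence (bound := fun i => ‖c i‖ * 2) (hc.mul_right 2)
    (fun i => Tendsto.const_mul (c i) (hasLogMean_pow (hz i))) ?_
  filter_upwards [tendsto_log_natCast.eventually_ge_atTop 1] with n hn i
  rw [norm_mul]
  refine mul_le_mul_of_nonneg_left ?_ (norm_nonneg _)
  have := norm_logAvg_le (a := fun m => z i ^ m) (B := 1)
    (fun m => by rw [norm_pow, hz, one_pow]) hn
  linarith

/-! ### The algebra of absolutely convergent character sums -/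

/-- Absolutely convergent sums of characters of `ℤ`, as sequences. -/
def IsCharSum (a : ℕ → ℂ) : Prop :=
  ∃ (ι : Type) (c z : ι → ℂ), (Summable fun i => ‖c i‖) ∧ (∀ i, ‖z i‖ = 1) ∧
    ∀ m, a m = ∑' i, c i * z i ^ m

theorem IsCharSum.exists_hasLogMean {a : ℕ → ℂ} (ha : IsCharSum a) : ∃ L, HasLogMean a L := by
  obtain ⟨ι, c, z, hc, hz, h⟩ := ha
  rw [funext h]
  exact ⟨_, hasLogMean_tsum hc hz⟩

theorem IsCharSum.mul {a b : ℕ → ℂ} (ha : IsCharSum a) (hb : IsCharSum b) :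
    IsCharSum fun m => a m * b m := by
  obtain ⟨ι, c, z, hc, hz, h⟩ := ha
  obtain ⟨κ, c', z', hc', hz', h'⟩ := hb
  have hn : ∀ {α : Type} {c z : α → ℂ}, (Summable fun i => ‖c i‖) → (∀ i, ‖z i‖ = 1) → ∀ m : ℕ,
      Summable fun i => ‖c i * z i ^ m‖ := fun hc hz m =>
    hc.congr fun i => by rw [norm_mul, norm_pow, hz, one_pow, mul_one]
  refine ⟨ι × κ, fun p => c p.1 * c' p.2, fun p => z p.1 * z' p.2, ?_, fun p => ?_, fun m => ?_⟩
  · exact hc.norm.mul_norm hc'.norm |>.congr fun p => by simp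
  · rw [norm_mul, hz, hz', one_mul]
  · dsimp only
    rw [h, h', tsum_mul_tsum_of_summable_norm (hn hc hz m) (hn hc' hz' m)]
    refine tsum_congr fun p => ?_
    rw [mul_pow]; ring

theorem isCharSum_one : IsCharSum fun _ => 1 :=
  ⟨Unit, fun _ => 1, fun _ => 1, Summable.of_finite, fun _ => by simp, fun m => by simp⟩

theorem IsCharSum.pow {a : ℕ → ℂ} (ha : IsCharSum a) (k : ℕ) : IsCharSum fun m => a m ^ k := by
  induction k with
  | zero => simpa using isCharSum_one
  | succ k ih => simpa only [pow_succ] using ih.mul ha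

theorem IsCharSum.conj {a : ℕ → ℂ} (ha : IsCharSum a) :
    IsCharSum fun m => (starRingEnd ℂ) (a m) := by
  obtain ⟨ι, c, z, hc, hz, h⟩ := ha
  refine ⟨ι, fun i => (starRingEnd ℂ) (c i), fun i => (starRingEnd ℂ) (z i), by simpa using hc,
    by simpa using hz, fun m => ?_⟩
  dsimp only
  rw [h, Complex.conj_tsum]
  simp

theorem IsCharSum.exists_norm_le {a : ℕ → ℂ} (ha : IsCharSum a) : ∃ B, ∀ m, ‖a m‖ ≤ B := by
  obtain ⟨ι, c, z, hc, hz, h⟩ := ha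
  refine ⟨∑' i, ‖c i‖, fun m => ?_⟩
  rw [h]
  exact tsum_of_norm_bounded hc.hasSum fun i => by rw [norm_mul, norm_pow, hz, one_pow, mul_one]

/-- The modulus of an absolutely convergent sum of characters has a logarithmic mean. -/
theorem IsCharSum.exists_hasLogMean_norm {a : ℕ → ℂ} (ha : IsCharSum a) :
    ∃ L, HasLogMean (fun m => (‖a m‖ : ℂ)) L := by
  obtain ⟨B, hB⟩ := ha.exists_norm_le
  refine exists_hasLogMean_of_approx fun ε hε => ?_
  -- The modulus is the square root of `a · conj a`. By Weierstrass it is uniformly close to a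
  -- polynomial in `a · conj a`, and powers of this product are again character sums.
  obtain ⟨p, hp⟩ := exists_polynomial_near_of_continuousOn 0 (B ^ 2) Real.sqrt
    Real.continuous_sqrt.continuousOn ε hε
  have hq : ∀ k, ∃ L, HasLogMean (fun m => (((‖a m‖ ^ 2) ^ k : ℝ) : ℂ)) L := by
    intro k
    obtain ⟨L, hL⟩ := ((ha.mul ha.conj).pow k).exists_hasLogMean
    refine ⟨L, ?_⟩
    convert hL using 2 with m
    rw [Complex.mul_conj, Complex.normSq_eq_norm_sq]
    push_cast; ring
  choose L hL using hq
  refine ⟨fun m => ∑ k ∈ Finset.range (p.natDegree + 1),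
    (p.coeff k : ℂ) * (((‖a m‖ ^ 2) ^ k : ℝ) : ℂ), _,
    HasLogMean.finsetSum _ fun k _ => (hL k).const_mul _, fun m => ?_⟩
  have h1 := hp (‖a m‖ ^ 2) ⟨by positivity, by have := hB m; gcongr⟩
  rw [Real.sqrt_sq (norm_nonneg _), Polynomial.eval_eq_sum_range, abs_sub_comm] at h1
  refine le_trans (le_of_eq ?_) h1.le
  rw [← Real.norm_eq_abs, ← Complex.norm_real]
  congr 1
  push_cast
  rfl

theorem HasLogMean.norm_le {a : ℕ → ℂ} {L M : ℂ} (ha : HasLogMean a L)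
    (hM : HasLogMean (fun m => (‖a m‖ : ℂ)) M) : ‖L‖ ≤ M.re := by
  refine le_of_tendsto_of_tendsto (ha.norm)
    ((Complex.continuous_re.tendsto M).comp hM) ?_
  filter_upwards [tendsto_log_natCast.eventually_gt_atTop 0] with n hn
  have e : logAvg (fun m => (‖a m‖ : ℂ)) n =
      (((∑ m ∈ Finset.range n, ‖a (m + 1)‖ / ((m : ℝ) + 1)) / Real.log n : ℝ) : ℂ) := by
    rw [logAvg]; push_cast; rfl
  simp only [Function.comp, e, Complex.ofReal_re]
  rw [logAvg, norm_div, Complex.norm_real, Real.norm_eq_abs, abs_of_pos hn]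
  gcongr
  refine norm_sum_le_of_le _ fun m _ => ?_
  have : ‖(m : ℂ) + 1‖ = (m : ℝ) + 1 := by
    rw [← Nat.cast_succ, Complex.norm_natCast]; push_cast; ring
  rw [norm_div, this]

/-! ### Averages with respect to a sequence of logarithmic growth -/

/-- A Stolz-Cesàro comparison with the increments of `log²`: the quotient of the terms is `G m /
(log (m + 1) + log m)`, which tends to `C / 2`. The comparison sum telescopes to `log² n` because
`log 0 = 0`. -/
theorem tendsto_sum_mul_log_sub_log {G : ℕ → ℝ} {C : ℝ}
    (hG : Tendsto (fun n : ℕ => G n / Real.log n) atTop (𝓝 C)) :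
    Tendsto (fun n : ℕ => (∑ m ∈ Finset.range n, G m * (Real.log (m + 1) - Real.log m)) /
      Real.log n ^ 2) atTop (𝓝 (C / 2)) := by
  let v : ℕ → ℝ := fun m => Real.log (m + 1) ^ 2 - Real.log m ^ 2
  have hsum : ∀ n : ℕ, ∑ m ∈ Finset.range n, v m = Real.log n ^ 2 := by
    intro n
    have := Finset.sum_range_sub (fun m : ℕ => Real.log m ^ 2) n
    simpa [v] using this
  have hlogle : ∀ m : ℕ, Real.log m ≤ Real.log (m + 1) := by
    intro m
    rcases Nat.eq_zero_or_pos m with rfl | hm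
    · simp
    · have : (0 : ℝ) < m := by exact_mod_cast hm
      exact Real.log_le_log this (by linarith)
  have hlog0 : ∀ m : ℕ, 0 ≤ Real.log m := fun m => Real.log_natCast_nonneg m
  have hv0 : 0 ≤ v := fun m => by
    have := hlogle m
    have := hlog0 m
    simp only [v, Pi.zero_apply, sub_nonneg]
    gcongr
  have hratio : Tendsto (fun m : ℕ => Real.log (m + 1) / Real.log m) atTop (𝓝 1) := by
    have h1 : Tendsto (fun m : ℕ => Real.log ((m : ℝ) + 1) - Real.log m) atTop (𝓝 0) := by
      have := Real.tendsto_log_nat_add_one_sub_log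
      exact this
    have h2 := (h1.div_atTop tendsto_log_natCast).add_const 1
    rw [zero_add] at h2
    refine h2.congr' ?_
    filter_upwards [tendsto_log_natCast.eventually_gt_atTop 0] with n hn
    field_simp
    ring
  have hq : Tendsto (fun m : ℕ => G m / (Real.log (m + 1) + Real.log m)) atTop (𝓝 (C / 2)) := by
    have h1 := hG.div (hratio.add_const 1) (by norm_num)
    rw [one_add_one_eq_two] at h1
    refine h1.congr' ?_
    filter_upwards [tendsto_log_natCast.eventually_gt_atTop 0] with n hn
    simp only [Pi.div_apply]
    have := hlogle n
    field_simp
  have hvpos : ∀ᶠ m : ℕ in atTop, 0 < Real.log (m + 1) - Real.log m := by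
    filter_upwards [eventually_gt_atTop 0] with m hm
    have : (0 : ℝ) < m := by exact_mod_cast hm
    exact sub_pos.2 (Real.log_lt_log this (by linarith))
  have ho : (fun m : ℕ => G m * (Real.log (m + 1) - Real.log m) - C / 2 * v m) =o[atTop] v := by
    refine (Asymptotics.isLittleO_iff_tendsto' ?_).2 ?_
    · filter_upwards [hvpos, tendsto_log_natCast.eventually_gt_atTop 0] with m hm hm' h0
      have h1 : v m = (Real.log (m + 1) - Real.log m) * (Real.log (m + 1) + Real.log m) := by
        simp only [v]; ring
      have h2 := hlogle m
      rw [h1] at h0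
      have := mul_pos hm (by linarith : 0 < Real.log (m + 1) + Real.log m)
      linarith
    · have h1 := hq.sub_const (C / 2)
      rw [sub_self] at h1
      refine h1.congr' ?_
      filter_upwards [hvpos, tendsto_log_natCast.eventually_gt_atTop 0] with m hm hm'
      have h1 : v m = (Real.log (m + 1) - Real.log m) * (Real.log (m + 1) + Real.log m) := by
        simp only [v]; ring
      have h2 : Real.log (m + 1) + Real.log m ≠ 0 := by
        have := hlogle m
        linarith
      rw [h1]
      field_simp
  have hlogsq : Tendsto (fun n : ℕ => Real.log n ^ 2) atTop atTop :=
    (tendsto_pow_atTop two_ne_zero).comp tendsto_log_natCast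
  have hs := ho.sum_range hv0 (by simpa only [hsum] using hlogsq)
  simp only [hsum, Finset.sum_sub_distrib, ← Finset.mul_sum] at hs
  have hs2 := hs.tendsto_div_nhds_zero.add_const (C / 2)
  rw [zero_add] at hs2
  refine hs2.congr' ?_
  filter_upwards [hlogsq.eventually_gt_atTop 0] with n hn
  rw [sub_div, mul_div_assoc, div_self hn.ne']
  ring

/-- Weighted sums `∑_{m ≤ n} ψ_m (G_m - G_{m-1})`. -/
def weightedSum (G : ℕ → ℝ) (ψ : ℕ → ℂ) : ℕ → ℂ
  | 0 => ψ 0 * G 0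
  | n + 1 => weightedSum G ψ n + ψ (n + 1) * ((G (n + 1) - G n : ℝ) : ℂ)

theorem weightedSum_add (G : ℕ → ℝ) (ψ χ : ℕ → ℂ) (n : ℕ) :
    weightedSum G (fun m => ψ m + χ m) n = weightedSum G ψ n + weightedSum G χ n := by
  induction n with
  | zero => simp [weightedSum, add_mul]
  | succ n ih => simp only [weightedSum, ih]; ring

theorem weightedSum_const_mul (G : ℕ → ℝ) (c : ℂ) (ψ : ℕ → ℂ) (n : ℕ) :
    weightedSum G (fun m => c * ψ m) n = c * weightedSum G ψ n := by
  induction n with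
  | zero => simp [weightedSum, mul_assoc]
  | succ n ih => simp only [weightedSum, ih]; ring

theorem norm_weightedSum_le {G : ℕ → ℝ} (hG0 : 0 ≤ G 0) (hG : Monotone G) {ψ : ℕ → ℂ} {n : ℕ}
    {B : ℝ} (hψ : ∀ m ≤ n, ‖ψ m‖ ≤ B) : ‖weightedSum G ψ n‖ ≤ B * G n := by
  have key : ∀ k ≤ n, ‖weightedSum G ψ k‖ ≤ B * G k := by
    intro k
    induction k with
    | zero =>
      intro h
      simp only [weightedSum, norm_mul, Complex.norm_real, Real.norm_eq_abs, abs_of_nonneg hG0]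
      exact mul_le_mul_of_nonneg_right (hψ 0 h) hG0
    | succ k ih =>
      intro h
      have h1 := ih (by omega)
      have h2 : 0 ≤ G (k + 1) - G k := sub_nonneg.2 (hG (Nat.le_succ k))
      refine (norm_add_le _ _).trans ?_
      rw [norm_mul, Complex.norm_real, Real.norm_eq_abs, abs_of_nonneg h2]
      have h3 := mul_le_mul_of_nonneg_right (hψ (k + 1) h) h2
      linarith
  exact key n le_rfl

/-- All `ψ m` with `m ≤ n` are at most a small multiple of `log n`: the late ones by assumption, the
finitely many early ones once `log n` is large. No growth of `G` is required, which covers points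
without a jump. -/
theorem tendsto_weightedSum_of_isLittleO {G : ℕ → ℝ} (hG0 : 0 ≤ G 0) (hG : Monotone G)
    {ψ : ℕ → ℂ} (hψ : Tendsto (fun n : ℕ => ψ n / (Real.log n : ℂ)) atTop (𝓝 0)) :
    Tendsto (fun n : ℕ => weightedSum G ψ n / ((Real.log n * G n : ℝ) : ℂ)) atTop (𝓝 0) := by
  have hGn : ∀ n, 0 ≤ G n := fun n => hG0.trans (hG (Nat.zero_le n))
  rw [Metric.tendsto_atTop]
  intro ε hε
  obtain ⟨N, hN⟩ := (Metric.tendsto_atTop.1 hψ) (ε / 4) (by positivity)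
  obtain ⟨B, hB0, hB⟩ : ∃ B : ℝ, 0 ≤ B ∧ ∀ m ≤ N + 1, ‖ψ m‖ ≤ B := by
    refine ⟨∑ m ∈ Finset.range (N + 2), ‖ψ m‖, Finset.sum_nonneg fun _ _ => norm_nonneg _,
      fun m hm => ?_⟩
    exact Finset.single_le_sum (f := fun m => ‖ψ m‖) (fun _ _ => norm_nonneg _)
      (Finset.mem_range.2 (by omega))
  obtain ⟨N', hN'⟩ := eventually_atTop.1
    (tendsto_log_natCast.eventually_ge_atTop (max 1 (4 * B / ε)))
  refine ⟨max N' 1, fun n hn => ?_⟩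
  have hlog := hN' n (le_of_max_le_left hn)
  have hlog1 : 1 ≤ Real.log n := (le_max_left _ _).trans hlog
  have hlogB : B ≤ ε / 4 * Real.log n := by
    have := (le_max_right _ _).trans hlog
    rw [div_le_iff₀ hε] at this
    linarith
  have hbound : ∀ m ≤ n, ‖ψ m‖ ≤ ε / 2 * Real.log n := by
    intro m hm
    rcases le_or_gt m (N + 1) with h | h
    · exact (hB m h).trans (by nlinarith)
    · have h1 := hN m (by omega)
      rw [dist_zero_right, norm_div, Complex.norm_real, Real.norm_eq_abs,
        abs_of_nonneg (Real.log_natCast_nonneg m)] at h1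
      have hm1 : (1 : ℝ) < m := by exact_mod_cast (by omega : 1 < m)
      have hmn : Real.log m ≤ Real.log n :=
        Real.log_le_log (by linarith) (by exact_mod_cast hm)
      rw [div_lt_iff₀ (Real.log_pos hm1)] at h1
      nlinarith
  have hT := norm_weightedSum_le hG0 hG hbound
  rw [dist_zero_right, norm_div, Complex.norm_real, Real.norm_eq_abs,
    abs_of_nonneg (mul_nonneg (by linarith) (hGn n))]
  -- If `G n = 0` the quotient is `0` by the convention for division by zero.
  rcases (hGn n).eq_or_lt with h0 | h0
  · rw [← h0]; simpa using hε
  · rw [div_lt_iff₀ (mul_pos (by linarith) h0)]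
    have : 0 < Real.log n * G n := mul_pos (by linarith) h0
    nlinarith

theorem weightedSum_log (G : ℕ → ℝ) (n : ℕ) :
    weightedSum G (fun m => (Real.log m : ℂ)) n =
      ((Real.log n * G n -
        ∑ m ∈ Finset.range n, G m * (Real.log (m + 1) - Real.log m) : ℝ) : ℂ) := by
  induction n with
  | zero => simp [weightedSum]
  | succ n ih =>
    rw [weightedSum, ih, Finset.sum_range_succ]
    push_cast
    ring

/-- Write `ψ m = L log m + o(log m)`. For `log m`, summation by parts leaves `log n * G n` minus a
sum asymptotic to `C log² n / 2`, which is half of the first term. -/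
theorem tendsto_weightedSum {G : ℕ → ℝ} (hG0 : 0 ≤ G 0) (hG : Monotone G) {C : ℝ} (hC : 0 < C)
    (hGC : Tendsto (fun n : ℕ => G n / Real.log n) atTop (𝓝 C)) {ψ : ℕ → ℂ} {L : ℂ}
    (hψ : Tendsto (fun n : ℕ => ψ n / (Real.log n : ℂ)) atTop (𝓝 L)) :
    Tendsto (fun n : ℕ => weightedSum G ψ n / ((Real.log n * G n : ℝ) : ℂ)) atTop
      (𝓝 (L / 2)) := by
  have h1 : Tendsto (fun n : ℕ => (ψ n - L * Real.log n) / (Real.log n : ℂ)) atTop (𝓝 0) := by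
    have := hψ.sub_const L
    rw [sub_self] at this
    refine this.congr' ?_
    filter_upwards [tendsto_log_natCast.eventually_gt_atTop 0] with n hn
    have : (Real.log n : ℂ) ≠ 0 := by exact_mod_cast hn.ne'
    field_simp
  have h2 := tendsto_weightedSum_of_isLittleO hG0 hG h1
  have h3 : Tendsto (fun n : ℕ => (Real.log n * G n -
      ∑ m ∈ Finset.range n, G m * (Real.log (m + 1) - Real.log m)) / (Real.log n * G n)) atTop
      (𝓝 (1 / 2)) := by
    have h4 := ((tendsto_sum_mul_log_sub_log hGC).div hGC hC.ne').const_sub 1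
    have e : 1 - C / 2 / C = 1 / 2 := by field_simp; norm_num
    rw [e] at h4
    refine h4.congr' ?_
    filter_upwards [tendsto_log_natCast.eventually_gt_atTop 0,
      hGC.eventually (lt_mem_nhds hC)] with n hn hg
    have hg' : 0 < G n := by
      have := mul_pos hg hn
      rwa [div_mul_cancel₀ _ hn.ne'] at this
    simp only [Pi.div_apply]
    field_simp
  have h5 := (((Complex.continuous_ofReal.tendsto _).comp h3).const_mul L).add h2
  have e : L * ((1 / 2 : ℝ) : ℂ) + 0 = L / 2 := by push_cast; ring
  rw [e] at h5
  refine h5.congr fun n => ?_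
  have e2 : weightedSum G ψ n = L * weightedSum G (fun m => (Real.log m : ℂ)) n +
      weightedSum G (fun m => ψ m - L * Real.log m) n := by
    rw [← weightedSum_const_mul, ← weightedSum_add]
    congr 1
    funext m
    ring
  rw [e2, weightedSum_log, add_div]
  simp only [Function.comp]
  push_cast
  ring

end

/-! ### Sums over boxes of frequencies -/

section

variable {d : ℕ} {f : (Fin d → ℝ) → ℝ} {J : Fin d → ℝ → ℝ}

theorem mem_freqBox {n : ℕ} {ν : Fin d → ℤ} : ν ∈ freqBox d n ↔ supNorm ν ≤ n := by
  simp only [freqBox, supNorm, Fintype.mem_piFinset, Finset.mem_Icc, Finset.sup_le_iff,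
    Finset.mem_univ, true_imp_iff]
  exact forall_congr' fun k => by omega

theorem freqBox_mono : Monotone (freqBox d) := fun _ _ h _ hν =>
  mem_freqBox.2 ((mem_freqBox.1 hν).trans h)

theorem summable_max_one_abs_int_rpow {b : ℝ} (hb : 1 < b) :
    Summable fun m : ℤ => (max 1 |(m : ℝ)|) ^ (-b) := by
  have h0 : Summable fun m : ℤ => if m = 0 then (1 : ℝ) else 0 :=
    summable_of_ne_finset_zero (s := {0}) fun m hm => by
      rw [if_neg (by simpa using hm)]
  refine ((Real.summable_abs_int_rpow hb).add h0).of_nonneg_of_le (fun m => by positivity)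
    fun m => ?_
  split_ifs with h
  · subst h
    simp only [Int.cast_zero, abs_zero, zero_le_one, sup_of_le_left, Real.one_rpow]
    have := Real.rpow_nonneg (le_refl (0 : ℝ)) (-b)
    linarith
  · have : (1 : ℝ) ≤ |(m : ℝ)| := by
      rw [← Int.cast_abs]; exact_mod_cast Int.one_le_abs h
    rw [max_eq_right this, add_zero]

/-- Products of powers of the frequencies have bounded sums over the boxes. -/
theorem sum_freqBox_prod_rpow_le {b : ℝ} (hb : 1 < b) (n : ℕ) :
    ∑ ν ∈ freqBox d n, ∏ k, (max 1 |(ν k : ℝ)|) ^ (-b) ≤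
      (∑' m : ℤ, (max 1 |(m : ℝ)|) ^ (-b)) ^ d := by
  rw [freqBox, ← Finset.prod_univ_sum (fun _ : Fin d => Finset.Icc (-(n : ℤ)) n)
    (fun _ (m : ℤ) => (max 1 |(m : ℝ)|) ^ (-b)), Finset.prod_const, Finset.card_univ,
    Fintype.card_fin]
  have := (summable_max_one_abs_int_rpow hb).sum_le_tsum (Finset.Icc (-(n : ℤ)) n)
    fun m _ => by positivity
  have h0 : 0 ≤ ∑ m ∈ Finset.Icc (-(n : ℤ)) n, (max 1 |(m : ℝ)|) ^ (-b) :=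
    Finset.sum_nonneg fun m _ => by positivity
  gcongr

/-- Take `j` with `|ν_j|` maximal. The product is then at most `|ν_j|^d`, so `|ν_j|` dominates its
`d`-th root, and every exponent becomes `1 + 1/d > 1`. -/
theorem one_div_mul_prod_le {ν : Fin d → ℤ} (hν : ν ≠ 0) :
    ∃ j, ν j ≠ 0 ∧ 1 / (|(ν j : ℝ)| * ∏ k, max 1 |(ν k : ℝ)|) ≤
      ∏ k, (max 1 |(ν k : ℝ)|) ^ (-(1 + 1 / (d : ℝ))) := by
  obtain ⟨i, hi⟩ := Function.ne_iff.1 hν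
  have hd : (0 : ℝ) < d := by exact_mod_cast i.pos
  obtain ⟨j, -, hj⟩ := Finset.exists_max_image Finset.univ (fun k => |ν k|) ⟨i, Finset.mem_univ i⟩
  have hj1 : 1 ≤ |ν j| := (Int.one_le_abs hi).trans (hj i (Finset.mem_univ i))
  have hj1' : (1 : ℝ) ≤ |(ν j : ℝ)| := by rw [← Int.cast_abs]; exact_mod_cast hj1
  refine ⟨j, fun h => by simp [h] at hj1, ?_⟩
  have hP1 : ∀ k ∈ Finset.univ, (0 : ℝ) ≤ max 1 |(ν k : ℝ)| := fun k _ => by positivity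
  have hP : 0 < ∏ k, max 1 |(ν k : ℝ)| := Finset.prod_pos fun k _ => by positivity
  have hle : ∏ k, max 1 |(ν k : ℝ)| ≤ |(ν j : ℝ)| ^ d := by
    have := Finset.prod_le_prod hP1 (g := fun _ => |(ν j : ℝ)|) fun k hk => max_le hj1' (by
      rw [← Int.cast_abs, ← Int.cast_abs]; exact_mod_cast hj k hk)
    simpa using this
  have hroot : (∏ k, max 1 |(ν k : ℝ)|) ^ (1 / (d : ℝ)) ≤ |(ν j : ℝ)| := by
    refine (Real.rpow_le_rpow hP.le hle (by positivity)).trans_eq ?_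
    rw [← Real.rpow_natCast, ← Real.rpow_mul (by positivity), mul_one_div, div_self hd.ne',
      Real.rpow_one]
  rw [Real.finsetProd_rpow _ _ hP1, Real.rpow_neg hP.le, Real.rpow_add hP, Real.rpow_one,
    ← one_div, mul_comm]
  gcongr

namespace HasHyperplaneJumps

/-- The Fourier series of the regular part converges absolutely. -/
theorem exists_sum_norm_regularPart_le (hf : HasHyperplaneJumps f J) (hd : 0 < d) :
    ∃ B : ℝ, ∀ n, ∑ ν ∈ freqBox d n, ‖fourierCoeffTorus (regularPart f J) ν‖ ≤ B := by
  obtain ⟨C, hC0, hC⟩ := hf.norm_fourierCoeffTorus_regularPart_le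
  set D := C + ‖fourierCoeffTorus (regularPart f J) 0‖
  have hb : 1 < 1 + 1 / (d : ℝ) := by
    have : (0 : ℝ) < d := by exact_mod_cast hd
    simpa using this
  have hD : 0 ≤ D := by positivity
  have key : ∀ ν : Fin d → ℤ, ‖fourierCoeffTorus (regularPart f J) ν‖ ≤
      D * ∏ k, (max 1 |(ν k : ℝ)|) ^ (-(1 + 1 / (d : ℝ))) := by
    intro ν
    rcases eq_or_ne ν 0 with rfl | hν
    · simp only [Pi.zero_apply, Int.cast_zero, abs_zero, zero_le_one, sup_of_le_left,
        Real.one_rpow, Finset.prod_const_one, mul_one, D]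
      linarith
    · obtain ⟨j, hj, hle⟩ := one_div_mul_prod_le hν
      refine (hC ν j hj).trans ?_
      rw [← mul_one_div]
      exact mul_le_mul (by simp [D]) hle (by positivity) hD
  refine ⟨D * (∑' m : ℤ, (max 1 |(m : ℝ)|) ^ (-(1 + 1 / (d : ℝ)))) ^ d, fun n => ?_⟩
  calc _ ≤ ∑ ν ∈ freqBox d n, D * ∏ k, (max 1 |(ν k : ℝ)|) ^ (-(1 + 1 / (d : ℝ))) :=
        Finset.sum_le_sum fun ν _ => key ν
    _ ≤ _ := by
        rw [← Finset.mul_sum]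
        exact mul_le_mul_of_nonneg_left (sum_freqBox_prod_rpow_le hb n) hD

end HasHyperplaneJumps

/-- The Fourier coefficients of the jump part in the direction `e_k`. -/
def axisCoeff (J : Fin d → ℝ → ℝ) (k : Fin d) (ν : Fin d → ℤ) : ℂ :=
  if ∀ l, l ≠ k → ν l = 0 then jumpCoeff (jumpWeight J k) (ν k) else 0

theorem HasHyperplaneJumps.fourierCoeffTorus_eq (hf : HasHyperplaneJumps f J) (ν : Fin d → ℤ) :
    fourierCoeffTorus f ν =
      fourierCoeffTorus (regularPart f J) ν + ∑ k, axisCoeff J k ν := by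
  have hfin : IsFiniteMeasure ((volume : Measure (Fin d → ℝ)).restrict
      (Icc (0 : Fin d → ℝ) (fun _ => 2 * Real.pi))) :=
    ⟨by simpa using isCompact_Icc.measure_lt_top⟩
  have hF : IntegrableOn (regularPart f J) (Icc (0 : Fin d → ℝ) (fun _ => 2 * Real.pi)) := by
    simpa using hf.integrableOn_regularPart_add 0
  have hk : ∀ k, IntegrableOn (fun x : Fin d → ℝ => jumpPart (jumpWeight J k) (x k))
      (Icc (0 : Fin d → ℝ) (fun _ => 2 * Real.pi)) := fun k =>
    Integrable.of_bound (hf.measurable_jumpPart_eval k).aestronglyMeasurable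
      _ (Eventually.of_forall fun x => abs_jumpPart_le (hf.summable_jump k) (x k))
  have hsum : ∑ k, axisCoeff J k ν =
      ∑ k, fourierCoeffTorus (fun x => jumpPart (jumpWeight J k) (x k)) ν :=
    Finset.sum_congr rfl fun k _ => (fourierCoeffTorus_jumpPart (hf.summable_jump k) k ν).symm
  rw [hsum]
  simp only [fourierCoeffTorus]
  rw [← Finset.mul_sum, ← mul_add, ← integral_finsetSum _ fun k _ =>
    integrableOn_mul_character (hk k) (-ν), ← integral_add (integrableOn_mul_character hF (-ν))
    (integrable_finsetSum _ fun k _ => integrableOn_mul_character (hk k) (-ν))]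
  congr 1
  refine integral_congr_ae (Eventually.of_forall fun x => ?_)
  dsimp only
  rw [← Finset.sum_mul, ← add_mul, regularPart]
  push_cast
  ring

theorem jumpCoeff_zero (w : ℝ → ℝ) : jumpCoeff w 0 = 0 := if_pos rfl

/-- A nonzero frequency lies on at most one axis, and at `0` all terms vanish. Hence different
directions do not cancel in the coefficient sums. -/
theorem norm_sum_axisCoeff (J : Fin d → ℝ → ℝ) (ν : Fin d → ℤ) :
    ‖∑ k, axisCoeff J k ν‖ = ∑ k, ‖axisCoeff J k ν‖ := by
  by_cases h : ∃ k, ν k ≠ 0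
  · obtain ⟨k, hk⟩ := h
    have h0 : ∀ l ∈ Finset.univ, l ≠ k → axisCoeff J l ν = 0 := fun l _ hl =>
      if_neg fun h => hk (h k hl.symm)
    rw [Finset.sum_eq_single k h0 (by simp), Finset.sum_eq_single k
      (fun l hl hlk => by rw [h0 l hl hlk, norm_zero]) (by simp)]
  · push Not at h
    have h0 : ∀ l, axisCoeff J l ν = 0 := fun l => by
      simp [axisCoeff, h, jumpCoeff_zero]
    simp [h0]

theorem sum_freqBox_axis {E : Type*} [AddCommMonoid E] (k : Fin d) (n : ℕ)
    (φ : (Fin d → ℤ) → E) :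
    ∑ ν ∈ freqBox d n, (if ∀ l, l ≠ k → ν l = 0 then φ ν else 0) =
      ∑ m ∈ Finset.Icc (-(n : ℤ)) n, φ (Pi.single k m) := by
  rw [← Finset.sum_filter]
  refine Finset.sum_bij' (fun ν _ => ν k) (fun m _ => Pi.single k m) ?_ ?_ ?_ ?_ ?_
  · intro ν hν
    exact Fintype.mem_piFinset.1 (Finset.mem_filter.1 hν).1 k
  · intro m hm
    refine Finset.mem_filter.2 ⟨Fintype.mem_piFinset.2 fun l => ?_, fun l hl => by simp [hl]⟩
    by_cases hl : l = k
    · subst hl; simpa using hm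
    · simp [hl]
  · intro ν hν
    funext l
    by_cases hl : l = k
    · subst hl; simp
    · simp [hl, (Finset.mem_filter.1 hν).2 l hl]
  · intro m _; simp
  · intro ν hν
    congr 1
    funext l
    by_cases hl : l = k
    · subst hl; simp
    · simp [hl, (Finset.mem_filter.1 hν).2 l hl]

theorem sum_Icc_neg_self {E : Type*} [AddCommMonoid E] (φ : ℤ → E) (n : ℕ) :
    ∑ m ∈ Finset.Icc (-(n : ℤ)) n, φ m =
      φ 0 + ∑ m ∈ Finset.range n, (φ ((m + 1 : ℕ) : ℤ) + φ (-((m + 1 : ℕ) : ℤ))) := by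
  induction n with
  | zero => simp
  | succ n ih =>
    have h : Finset.Icc (-((n + 1 : ℕ) : ℤ)) ((n + 1 : ℕ) : ℤ) =
        insert ((n + 1 : ℕ) : ℤ) (insert (-((n + 1 : ℕ) : ℤ)) (Finset.Icc (-(n : ℤ)) n)) := by
      ext m
      simp only [Finset.mem_Icc, Finset.mem_insert]
      push_cast
      omega
    rw [h, Finset.sum_insert, Finset.sum_insert, ih, Finset.sum_range_succ]
    · abel
    · simp
    · simp; omega

/-- Sums over the frequency boxes are weighted sums along the maximum norm. -/
theorem sum_freqBox_eq_weightedSum (f : (Fin d → ℝ) → ℝ) (ψ : ℕ → ℂ) (n : ℕ) :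
    ∑ ν ∈ freqBox d n, ψ (supNorm ν) * (‖fourierCoeffTorus f ν‖ : ℂ) =
      weightedSum (coeffSum f) ψ n := by
  induction n with
  | zero =>
    rw [weightedSum, coeffSum]
    push_cast
    rw [Finset.mul_sum]
    refine Finset.sum_congr rfl fun ν hν => ?_
    rw [Nat.le_zero.1 (mem_freqBox.1 hν)]
  | succ n ih =>
    have hsub := freqBox_mono (d := d) (Nat.le_succ n)
    rw [weightedSum, ← ih, ← Finset.sum_sdiff hsub, add_comm, coeffSum, coeffSum,
      ← Finset.sum_sdiff hsub, add_sub_cancel_right]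
    push_cast
    rw [Finset.mul_sum]
    congr 1
    refine Finset.sum_congr rfl fun ν hν => ?_
    have h := Finset.mem_sdiff.1 hν
    rw [mem_freqBox, mem_freqBox] at h
    rw [show supNorm ν = n + 1 by omega]

theorem coeffSum_mono (f : (Fin d → ℝ) → ℝ) : Monotone (coeffSum f) := fun _ _ h =>
  Finset.sum_le_sum_of_subset_of_nonneg (freqBox_mono h) fun _ _ _ => norm_nonneg _

theorem coeffSum_nonneg (f : (Fin d → ℝ) → ℝ) (n : ℕ) : 0 ≤ coeffSum f n :=
  Finset.sum_nonneg fun _ _ => norm_nonneg _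

end

/-! ### Growth of the coefficient sums and of the conjugate partial sums -/

section

variable {d : ℕ} {f : (Fin d → ℝ) → ℝ} {J : Fin d → ℝ → ℝ}

theorem expSum_neg (w : ℝ → ℝ) (m : ℤ) : expSum w (-m) = (starRingEnd ℂ) (expSum w m) := by
  rw [expSum, expSum, Complex.conj_tsum]
  refine tsum_congr fun α => ?_
  rw [map_mul, Complex.conj_ofReal, ← Complex.exp_conj]
  simp

theorem norm_expSum_neg (w : ℝ → ℝ) (m : ℤ) : ‖expSum w (-m)‖ = ‖expSum w m‖ := by
  rw [expSum_neg, RCLike.norm_conj]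

theorem expSum_mul_exp (w : ℝ → ℝ) (p : ℤ) (t : ℝ) :
    expSum w p * Complex.exp (Complex.I * p * t) =
      ∑' α : ℝ, (w α : ℂ) * Complex.exp (Complex.I * p * (t - α)) := by
  rw [expSum, ← tsum_mul_right]
  refine tsum_congr fun α => ?_
  rw [mul_assoc, ← Complex.exp_add]
  congr 2
  ring

theorem isCharSum_expSum {w : ℝ → ℝ} (hw : Summable w) :
    IsCharSum fun m => expSum w (m : ℕ) := by
  refine ⟨ℝ, fun α => w α, fun α => Complex.exp (-(Complex.I * (1 : ℤ) * α)), ?_,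
    fun α => norm_exp_neg_I_mul 1 α, fun m => tsum_congr fun α => ?_⟩
  · simpa using hw.abs
  · rw [← Complex.exp_nat_mul]
    congr 2
    push_cast; ring

namespace HasHyperplaneJumps

/-- Exactly one `α` in `(0, 2π]` is congruent to `t` modulo `2π`, and `J k` is periodic. -/
theorem tsum_jumpWeight_mul_ite (hf : HasHyperplaneJumps f J) (k : Fin d) (t : ℝ) {ε : ℂ}
    (hε : ε = 1 ∨ ε = -1) :
    ∑' α : ℝ, (jumpWeight J k α : ℂ) *
      (if Complex.exp (ε * (Complex.I * (t - α))) = 1 then 1 else 0) = J k t := by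
  have hiff : ∀ α : ℝ, Complex.exp (ε * (Complex.I * (t - α))) = 1 ↔
      Complex.exp (Complex.I * (t - α)) = 1 := by
    intro α
    rcases hε with rfl | rfl
    · rw [one_mul]
    · rw [neg_one_mul, Complex.exp_neg, inv_eq_one]
  simp only [hiff]
  have hexp : ∀ α : ℝ, Complex.exp (Complex.I * (t - α)) = 1 ↔
      ∃ z : ℤ, t = α + z • (2 * Real.pi) := by
    intro α
    rw [Complex.exp_eq_one_iff]
    refine exists_congr fun z => ?_
    have e : (z : ℂ) * (2 * Real.pi * Complex.I) =
        Complex.I * ((z • (2 * Real.pi) : ℝ) : ℂ) := by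
      rw [zsmul_eq_mul]; push_cast; ring
    rw [e, mul_right_inj' Complex.I_ne_zero, ← Complex.ofReal_sub, Complex.ofReal_inj,
      sub_eq_iff_eq_add']
  have hmod := toIocMod_mem_Ioc Real.two_pi_pos 0 t
  rw [zero_add] at hmod
  rw [tsum_eq_single (toIocMod Real.two_pi_pos 0 t)]
  · rw [if_pos, mul_one, jumpWeight, indicator_of_mem hmod, toIocMod,
      (hf.jump_periodic k).sub_zsmul_eq]
    exact (hexp _).2 ⟨_, (toIocMod_add_toIocDiv_zsmul Real.two_pi_pos 0 t).symm⟩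
  · intro α hα
    by_cases h : α ∈ Ioc 0 (2 * Real.pi)
    · rw [if_neg, mul_zero]
      intro h1
      exact hα ((toIocMod_eq_iff Real.two_pi_pos).2 ⟨by rwa [zero_add], (hexp α).1 h1⟩).symm
    · rw [jumpWeight, indicator_of_notMem h]; simp

/-- The jump is recovered as a logarithmic mean of the rotated exponential sums. -/
theorem hasLogMean_expSum_mul_exp (hf : HasHyperplaneJumps f J) (k : Fin d) (t : ℝ) {ε : ℤ}
    (hε : ε = 1 ∨ ε = -1) :
    HasLogMean (fun m => expSum (jumpWeight J k) (ε * (m : ℕ)) *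
      Complex.exp (Complex.I * (ε * (m : ℕ) : ℤ) * t)) (J k t) := by
  have hε' : (ε : ℂ) = 1 ∨ (ε : ℂ) = -1 := by
    rcases hε with rfl | rfl <;> simp
  have h := hasLogMean_tsum (c := fun α => (jumpWeight J k α : ℂ))
    (z := fun α : ℝ => Complex.exp (ε * (Complex.I * (t - α))))
    (by simpa [jumpWeight] using (hf.summable_jump k).abs) (fun α => by
      have : (ε : ℂ) * (Complex.I * (t - α)) = ((ε * (t - α) : ℝ) : ℂ) * Complex.I := by
        push_cast; ring
      rw [this, Complex.norm_exp_ofReal_mul_I])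
  rw [hf.tsum_jumpWeight_mul_ite k t hε'] at h
  convert h using 2 with m
  rw [expSum_mul_exp]
  refine tsum_congr fun α => ?_
  rw [← Complex.exp_nat_mul]
  congr 2
  push_cast; ring

/-- The coefficient sums grow logarithmically, the factor being positive if `f` has a jump. -/
theorem exists_tendsto_coeffSum_div_log (hf : HasHyperplaneJumps f J) (hd : 0 < d) :
    ∃ C : ℝ, Tendsto (fun n : ℕ => coeffSum f n / Real.log n) atTop (𝓝 C) ∧
      ∀ k t, J k t ≠ 0 → 0 < C := by
  obtain ⟨B, hB⟩ := hf.exists_sum_norm_regularPart_le hd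
  have hM := fun k => (isCharSum_expSum (hf.summable_jump k)).exists_hasLogMean_norm
  choose M hM using hM
  -- The rotation by `e^{imt}` does not change the modulus, so the mean `J k t` of the rotated sums
  -- is bounded by the mean of the moduli. This gives the positivity of `C`.
  have hMJ : ∀ k t, |J k t| ≤ (M k).re := by
    intro k t
    have h := (hf.hasLogMean_expSum_mul_exp k t (Or.inl rfl)).norm_le (M := M k) (by
      convert hM k using 2 with m
      rw [norm_mul, one_mul]
      have : Complex.I * ((m : ℕ) : ℤ) * t = ((m * t : ℝ) : ℂ) * Complex.I := by
        push_cast; ring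
      rw [this, Complex.norm_exp_ofReal_mul_I, mul_one]
      rfl)
    rwa [Complex.norm_real, Real.norm_eq_abs] at h
  let A : Fin d → ℕ → ℝ := fun k n =>
    ∑ m ∈ Finset.range n, ‖expSum (jumpWeight J k) ((m + 1 : ℕ) : ℤ)‖ / ((m : ℝ) + 1)
  have hA : ∀ k, Tendsto (fun n : ℕ => A k n / Real.log n) atTop (𝓝 (M k).re) := by
    intro k
    refine ((Complex.continuous_re.tendsto _).comp (hM k)).congr fun n => ?_
    have e : logAvg (fun m => (‖expSum (jumpWeight J k) (m : ℕ)‖ : ℂ)) n =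
        ((A k n / Real.log n : ℝ) : ℂ) := by
      simp only [logAvg, A]; push_cast; rfl
    exact congrArg Complex.re e |>.trans (Complex.ofReal_re _)
  -- The frequencies `m` and `-m` contribute `|E_k(m)| / (2πm)` each.
  have haxis : ∀ n k, ∑ ν ∈ freqBox d n, ‖axisCoeff J k ν‖ = A k n / Real.pi := by
    intro n k
    have e : ∀ ν : Fin d → ℤ, ‖axisCoeff J k ν‖ =
        if ∀ l, l ≠ k → ν l = 0 then ‖jumpCoeff (jumpWeight J k) (ν k)‖ else 0 := by
      intro ν; unfold axisCoeff; split_ifs <;> simp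
    simp only [e]
    rw [sum_freqBox_axis k n fun ν => ‖jumpCoeff (jumpWeight J k) (ν k)‖]
    simp only [Pi.single_eq_same]
    rw [sum_Icc_neg_self, jumpCoeff_zero, norm_zero, zero_add, Finset.sum_div]
    refine Finset.sum_congr rfl fun m _ => ?_
    have hm : ((m + 1 : ℕ) : ℤ) ≠ 0 := by positivity
    have hnorm : ‖((m : ℂ) + 1)‖ = (m : ℝ) + 1 := by
      rw [← Nat.cast_succ, Complex.norm_natCast]; push_cast; ring
    rw [jumpCoeff, jumpCoeff, if_neg hm, if_neg (neg_ne_zero.2 hm), norm_div, norm_div,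
      norm_expSum_neg]
    have hpi := Real.pi_pos
    have h2 : ‖(2 * Real.pi * Complex.I * ((m + 1 : ℕ) : ℤ) : ℂ)‖ = 2 * Real.pi * (m + 1) := by
      push_cast
      simp only [norm_mul, hnorm, Complex.norm_I, Complex.norm_real, Real.norm_eq_abs,
        abs_of_pos hpi, Complex.norm_ofNat, mul_one]
    have h3 : ‖(2 * Real.pi * Complex.I * ((-((m + 1 : ℕ) : ℤ) : ℤ) : ℂ))‖ =
        2 * Real.pi * (m + 1) := by
      rw [Int.cast_neg, mul_neg, norm_neg, h2]
    rw [h2, h3]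
    field_simp
    ring
  have hdiff : ∀ n, |coeffSum f n - ∑ k, A k n / Real.pi| ≤ B := by
    intro n
    have e : ∑ k, A k n / Real.pi = ∑ ν ∈ freqBox d n, ‖∑ k, axisCoeff J k ν‖ := by
      simp only [norm_sum_axisCoeff, ← haxis]
      rw [Finset.sum_comm]
    rw [e, coeffSum, ← Finset.sum_sub_distrib]
    refine (Finset.abs_sum_le_sum_abs _ _).trans ((Finset.sum_le_sum fun ν _ => ?_).trans (hB n))
    rw [hf.fourierCoeffTorus_eq]
    refine (abs_norm_sub_norm_le _ _).trans_eq ?_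
    rw [add_sub_cancel_right]
  refine ⟨∑ k, (M k).re / Real.pi, ?_, fun k t hJ => ?_⟩
  · have h1 : Tendsto (fun n : ℕ => (coeffSum f n - ∑ k, A k n / Real.pi) / Real.log n) atTop
        (𝓝 0) :=
      tendsto_bdd_div_atTop_nhds_zero (b := -B) (B := B)
        (Eventually.of_forall fun n => (abs_le.1 (hdiff n)).1)
        (Eventually.of_forall fun n => (abs_le.1 (hdiff n)).2) tendsto_log_natCast
    have h2 := h1.add (tendsto_finsetSum Finset.univ fun k _ => (hA k).div_const Real.pi)
    rw [zero_add] at h2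
    refine h2.congr fun n => ?_
    rw [sub_div, Finset.sum_div, sub_add_eq_add_sub, sub_eq_iff_eq_add]
    congr 1
    exact Finset.sum_congr rfl fun k _ => div_right_comm _ _ _
  · refine Finset.sum_pos' (fun i _ => div_nonneg ((abs_nonneg _).trans (hMJ i 0))
      Real.pi_pos.le) ⟨k, Finset.mem_univ k, div_pos ?_ Real.pi_pos⟩
    exact (abs_pos.2 hJ).trans_le (hMJ k t)

/-- The conjugate partial sums grow like the jump times the logarithm. -/
theorem tendsto_conjPartialSum_div_log (hf : HasHyperplaneJumps f J) (hd : 0 < d) (j : Fin d)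
    (x : Fin d → ℝ) :
    Tendsto (fun n : ℕ => -conjPartialSum f j n x / (Real.log n : ℂ)) atTop
      (𝓝 ((J j (x j) / Real.pi : ℝ) : ℂ)) := by
  obtain ⟨B, hB⟩ := hf.exists_sum_norm_regularPart_le hd
  let w := jumpWeight J j
  let R : ℕ → ℂ := fun n => Complex.I * ∑ ν ∈ freqBox d n,
    ((ν j).sign : ℂ) * fourierCoeffTorus (regularPart f J) ν * character ν x
  have hR : ∀ n, ‖R n‖ ≤ B := by
    intro n
    rw [norm_mul, Complex.norm_I, one_mul]
    refine (norm_sum_le_of_le _ fun ν _ => ?_).trans (hB n)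
    rw [norm_mul, norm_mul, norm_character, mul_one]
    refine mul_le_of_le_one_left (norm_nonneg _) ?_
    rcases Int.sign_trichotomy (ν j) with h | h | h <;> simp [h]
  let a : ℕ → ℂ := fun m =>
    expSum w (1 * (m : ℕ)) * Complex.exp (Complex.I * (1 * (m : ℕ) : ℤ) * x j) +
    expSum w (-1 * (m : ℕ)) * Complex.exp (Complex.I * (-1 * (m : ℕ) : ℤ) * x j)
  have ha : HasLogMean a (J j (x j) + J j (x j)) :=
    (hf.hasLogMean_expSum_mul_exp j (x j) (Or.inl rfl)).add
      (hf.hasLogMean_expSum_mul_exp j (x j) (Or.inr rfl))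
  -- Since `i · sign(m) / (2πim) = 1 / (2π|m|)`, the conjugation makes the contributions of `m` and
  -- `-m` add up. The other axes drop out because `sign(ν_j) = 0` there.
  have haxis : ∀ n, Complex.I * ∑ ν ∈ freqBox d n,
      ((ν j).sign : ℂ) * (∑ k, axisCoeff J k ν) * character ν x =
      1 / (2 * Real.pi) * ∑ m ∈ Finset.range n, a (m + 1) / ((m : ℂ) + 1) := by
    intro n
    have e : ∀ ν : Fin d → ℤ, ((ν j).sign : ℂ) * (∑ k, axisCoeff J k ν) * character ν x =
        if ∀ l, l ≠ j → ν l = 0 then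
          ((ν j).sign : ℂ) * jumpCoeff w (ν j) * character ν x else 0 := by
      intro ν
      rw [Finset.mul_sum, Finset.sum_eq_single j]
      · rw [axisCoeff]; split_ifs <;> simp [w]
      · intro k _ hk
        rw [axisCoeff]
        split_ifs with h
        · simp [h j hk.symm]
        · simp
      · simp
    simp only [e]
    rw [sum_freqBox_axis j n fun ν => ((ν j).sign : ℂ) * jumpCoeff w (ν j) * character ν x]
    have hchar : ∀ m : ℤ, character (Pi.single j m) x = Complex.exp (Complex.I * m * x j) := by
      intro m
      rw [character, Finset.sum_eq_single j, mul_assoc]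
      · simp
      · intro l _ hl; simp [hl]
      · simp
    simp only [Pi.single_eq_same, hchar]
    rw [sum_Icc_neg_self, jumpCoeff_zero, mul_zero, zero_mul, zero_add, Finset.mul_sum,
      Finset.mul_sum]
    refine Finset.sum_congr rfl fun m _ => ?_
    have hm : ((m + 1 : ℕ) : ℤ) ≠ 0 := by positivity
    have hm' : (m : ℂ) + 1 ≠ 0 := by exact_mod_cast Nat.succ_ne_zero m
    have hpi : (Real.pi : ℂ) ≠ 0 := by exact_mod_cast Real.pi_ne_zero
    rw [jumpCoeff, jumpCoeff, if_neg hm, if_neg (neg_ne_zero.2 hm),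
      Int.sign_eq_one_of_pos (by positivity), Int.sign_neg, Int.sign_eq_one_of_pos (by positivity)]
    simp only [a, one_mul, neg_one_mul]
    push_cast
    have hI := Complex.I_ne_zero
    field_simp
  have hsplit : ∀ n, -conjPartialSum f j n x =
      R n + 1 / (2 * Real.pi) * ∑ m ∈ Finset.range n, a (m + 1) / ((m : ℂ) + 1) := by
    intro n
    rw [← haxis, conjPartialSum, neg_mul, neg_neg, ← mul_add, ← Finset.sum_add_distrib]
    congr 1
    refine Finset.sum_congr rfl fun ν _ => ?_
    rw [hf.fourierCoeffTorus_eq]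
    ring
  have hR0 : Tendsto (fun n : ℕ => R n / (Real.log n : ℂ)) atTop (𝓝 0) := by
    refine squeeze_zero_norm' (a := fun n : ℕ => B / Real.log n) ?_
      (tendsto_const_nhds.div_atTop tendsto_log_natCast)
    filter_upwards [tendsto_log_natCast.eventually_gt_atTop 0] with n hn
    rw [norm_div, Complex.norm_real, Real.norm_eq_abs, abs_of_pos hn]
    have := hR n
    gcongr
  have h := hR0.add (Tendsto.const_mul (1 / (2 * Real.pi) : ℂ) ha)
  have hpi : (Real.pi : ℂ) ≠ 0 := by exact_mod_cast Real.pi_ne_zero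
  have e : (0 : ℂ) + 1 / (2 * Real.pi) * (J j (x j) + J j (x j)) =
      ((J j (x j) / Real.pi : ℝ) : ℂ) := by
    push_cast; field_simp; ring
  rw [e] at h
  refine h.congr fun n => ?_
  rw [hsplit, logAvg, add_div, mul_div_assoc (1 / (2 * (Real.pi : ℂ)))]

theorem normalizedAverage_eq (f : (Fin d → ℝ) → ℝ) (j : Fin d) (n : ℕ) (x : Fin d → ℝ) :
    normalizedAverage f j n x =
      weightedSum (coeffSum f) (fun m => -conjPartialSum f j m x) n /
        ((Real.log n * coeffSum f n : ℝ) : ℂ) := by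
  rw [← sum_freqBox_eq_weightedSum, normalizedAverage]
  simp only [neg_mul, Finset.sum_neg_distrib]
  ring

theorem tendsto_normalizedAverage (hf : HasHyperplaneJumps f J) (hd : 0 < d) (j : Fin d)
    (x : Fin d → ℝ) :
    Tendsto (fun n : ℕ => normalizedAverage f j n x) atTop
      (𝓝 ((J j (x j) / Real.pi : ℝ) / 2 : ℂ)) := by
  have hψ := hf.tendsto_conjPartialSum_div_log hd j x
  simp only [normalizedAverage_eq]
  -- If `J j (x j) = 0`, all jumps may vanish and `G` may be bounded, so the version without growth
  -- of `G` is used.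
  rcases eq_or_ne (J j (x j)) 0 with h | h
  · simp only [h, zero_div, Complex.ofReal_zero] at hψ ⊢
    exact tendsto_weightedSum_of_isLittleO (coeffSum_nonneg f 0) (coeffSum_mono f) hψ
  · obtain ⟨C, hC, hpos⟩ := hf.exists_tendsto_coeffSum_div_log hd
    exact tendsto_weightedSum (coeffSum_nonneg f 0) (coeffSum_mono f) (hpos j _ h) hC hψ

end HasHyperplaneJumps

end

end TorusJump

end

/-! ### The theorem with its explicit constant -/

theorem lemma3p1 (d : ℕ) (hd : 2 ≤ d) :
    ∃ K : ℝ, 0 < K ∧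
      ∀ (f : (Fin d → ℝ) → ℝ) (J : Fin d → ℝ → ℝ), TorusJump.HasHyperplaneJumps f J →
        ∀ (j : Fin d) (x : Fin d → ℝ),
          Tendsto (fun n : ℕ => TorusJump.normalizedAverage f j n x) atTop
            (𝓝 ((K * (J j (x j) / (2 * Real.pi) ^ d) : ℝ) : ℂ)) := by
  -- The limit is `J / (2π)` in every dimension; the constant absorbs the remaining `d - 1` factors
  -- of the normalization `(2π)^d`.
  refine ⟨(2 * Real.pi) ^ (d - 1), by positivity, fun f J hf j x => ?_⟩
  have h := hf.tendsto_normalizedAverage (by omega) j x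
  have e : (2 * Real.pi) ^ (d - 1) * (J j (x j) / (2 * Real.pi) ^ d) =
      J j (x j) / Real.pi / 2 := by
    have hpi := Real.pi_ne_zero
    obtain ⟨m, rfl⟩ : ∃ m, d = m + 1 := ⟨d - 1, by omega⟩
    rw [Nat.add_sub_cancel, pow_succ]
    field_simp
  rw [e]
  push_cast at h ⊢
  exact h
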